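/- Let $n\ge 2$. Let $\mathcal M$ be the set of symbols $a_{i_1,\dots,i_k}$ with $1\le k\le n-1$ and $1\le i_1<\dots<i_k\le n$, ordered by $a_{i_1,\dots,i_k}\le a_{j_1,\dots,j_l}$ if and only if $k\ge l$ and $i_r\le j_r$ for all $1\le r\le l$; this is a finite distributive lattice. Let $R=\mathbb C[X_a : a\in\mathcal M]$ and consider the following ideals of $R$: the ideal $I$ of Plücker relations of the variety of complete flags in $\mathbb C^n$, that is, the kernel of the homomorphism $R\to\mathbb C[z_{i,j}: 1\le i,j\le n]$ sending $X_{a_{i_1,\dots,i_k}}$ to the determinant $\det(z_{r,i_s})_{1\le r,s\le k}$; the Hibi ideal $I^h(\mathcal M)$, generated by all $X_aX_b-X_{a\vee b}X_{a\wedge b}$ with $a,b\in\mathcal M$; and the monomial ideal $I^m(\mathcal M)$, generated by all products $X_aX_b$ with $a,b\in\mathcal M$ incomparable. For $w\in\mathbb R^{\mathcal M}$ and $p\in R$ let $\mathrm{in}_w p$ be the sum of those terms of $p$ whose exponent vectors $d$ have the least value of $\sum_{a} w_a d_a$ among all terms of $p$ (with $\mathrm{in}_w 0=0$), let $\mathrm{in}_w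 I$ be the $\mathbb C$-linear span of $\{\mathrm{in}_w p : p\in I\}$, and for an ideal $J\subset R$ let $C(I,J)=\{w\in\mathbb R^{\mathcal M} : \mathrm{in}_w I=J\}$, with closure $\overline{C(I,J)}$ in $\mathbb R^{\mathcal M}$. Theorem. Every facet $F$ (face of codimension one) of the closed polyhedral cone $\overline{C(I,I^m(\mathcal M))}$ either contains the closed polyhedral cone $\overline{C(I,I^h(\mathcal M))}$ (the closed cone of the Gelfand–Tsetlin toric degeneration) or is such that $F\cap\overline{C(I,I^h(\mathcal M))}$ is a facet of $\overline{C(I,I^h(\mathcal M))}$. -/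

import Mathlib

noncomputable section

/-! ### Initial ideals and Gröbner cones -/

section Groebner

variable {σ : Type*}

/-- The initial part of `p` with respect to `w`: the sum of those terms of `p` whose exponent
vectors `d` minimise `(w, d) = ∑ i, d i * w i` over the support of `p`. -/
def initialPart (w : σ → ℝ) (p : MvPolynomial σ ℂ) : MvPolynomial σ ℂ :=
  open Classical in
  ∑ d ∈ p.support with ∀ e ∈ p.support, Finsupp.weight w d ≤ Finsupp.weight w e,
    MvPolynomial.monomial d (p.coeff d)

/-- The initial ideal of `I` with respect to `w`: the complex linear span of the initial parts
of all elements of `I`. -/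
def initialSpan (w : σ → ℝ) (I : Ideal (MvPolynomial σ ℂ)) : Submodule ℂ (MvPolynomial σ ℂ) :=
  Submodule.span ℂ {q | ∃ p ∈ I, initialPart w p = q}

/-- The set `C(I, J)` of all weights `w` such that the initial ideal of `I` is `J`. -/
def groebnerCone (I J : Ideal (MvPolynomial σ ℂ)) : Set (σ → ℝ) :=
  {w | initialSpan w I = J.restrictScalars ℂ}

end Groebner

/-! ### Hibi ideals and ideals of non-standard monomials -/

/-- The Hibi ideal of a lattice, generated by all `X a * X b - X (a ⊔ b) * X (a ⊓ b)`. -/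
def hibiIdeal (L : Type*) [Lattice L] : Ideal (MvPolynomial L ℂ) :=
  Ideal.span {q | ∃ a b : L, q = MvPolynomial.X a * MvPolynomial.X b -
    MvPolynomial.X (a ⊔ b) * MvPolynomial.X (a ⊓ b)}

/-- The monomial ideal generated by the products `X a * X b` with `a`, `b` incomparable. -/
def nonstandardIdeal (L : Type*) [Lattice L] : Ideal (MvPolynomial L ℂ) :=
  Ideal.span {q | ∃ a b : L, ¬ a ≤ b ∧ ¬ b ≤ a ∧ q = MvPolynomial.X a * MvPolynomial.X b}

/-! ### Plücker variables -/

/-- The index of a Plücker variable: a tuple `i₁ < … < i_k` of elements of an `n`-element chain,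
where `1 ≤ k ≤ n - 1`. -/
structure PluckerIndex (n : ℕ) where
  /-- The number `k` of subscripts. -/
  len : ℕ
  len_pos : 0 < len
  len_lt : len < n
  /-- The subscripts, numbered from `0`. -/
  entry : Fin len → Fin n
  strictMono : StrictMono entry

namespace PluckerIndex

variable {n : ℕ}

/-- `a_{i₁,…,i_k} ≤ a_{j₁,…,j_l}` means that `k ≥ l` and `i_r ≤ j_r` for all `r ≤ l`. -/
instance : LE (PluckerIndex n) where
  le a b := ∃ h : b.len ≤ a.len, ∀ r : Fin b.len, a.entry (Fin.castLE h r) ≤ b.entry r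

/-- The meet: the longer length, and termwise minima (of the terms that exist). -/
protected def inf (a b : PluckerIndex n) : PluckerIndex n where
  len := max a.len b.len
  len_pos := lt_max_of_lt_left a.len_pos
  len_lt := max_lt a.len_lt b.len_lt
  entry r :=
    if ha : r.1 < a.len then
      if hb : r.1 < b.len then min (a.entry ⟨r, ha⟩) (b.entry ⟨r, hb⟩) else a.entry ⟨r, ha⟩
    else b.entry ⟨r, (lt_max_iff.1 r.2).resolve_left ha⟩
  strictMono := by
    intro r s hrs
    have hrs' : r.1 < s.1 := hrs
    have hA : ∀ (h : r.1 < a.len) (h' : s.1 < a.len), a.entry ⟨r, h⟩ < a.entry ⟨s, h'⟩ :=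
      fun h h' => a.strictMono hrs
    have hB : ∀ (h : r.1 < b.len) (h' : s.1 < b.len), b.entry ⟨r, h⟩ < b.entry ⟨s, h'⟩ :=
      fun h h' => b.strictMono hrs
    have h1 := r.2
    have h2 := s.2
    rw [lt_max_iff] at h1 h2
    dsimp only
    split_ifs <;> grind

/-- The join: the shorter length, and termwise maxima. -/
protected def sup (a b : PluckerIndex n) : PluckerIndex n where
  len := min a.len b.len
  len_pos := lt_min a.len_pos b.len_pos
  len_lt := min_lt_of_left_lt a.len_lt
  entry r := max (a.entry (Fin.castLE (min_le_left _ _) r))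
    (b.entry (Fin.castLE (min_le_right _ _) r))
  strictMono := fun _ _ hrs => max_lt_max (a.strictMono hrs) (b.strictMono hrs)

theorem le_def (a b : PluckerIndex n) : a ≤ b ↔ b.len ≤ a.len ∧
    ∀ (r : ℕ) (ha : r < a.len) (hb : r < b.len), a.entry ⟨r, ha⟩ ≤ b.entry ⟨r, hb⟩ :=
  ⟨fun ⟨h, h'⟩ => ⟨h, fun r _ hb => h' ⟨r, hb⟩⟩,
    fun ⟨h, h'⟩ => ⟨h, fun r => h' r.1 (r.2.trans_le h) r.2⟩⟩

/-- The poset of Plücker variables is a distributive lattice. -/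
instance : DistribLattice (PluckerIndex n) where
  le_refl a := ⟨le_rfl, fun _ => le_rfl⟩
  le_trans a b c hab hbc := by
    rw [le_def] at *
    exact ⟨hbc.1.trans hab.1, fun r ha hc =>
      (hab.2 r ha (hc.trans_le hbc.1)).trans (hbc.2 r _ hc)⟩
  le_antisymm a b hab hba := by
    rw [le_def] at hab hba
    obtain ⟨k, _, _, f, _⟩ := a
    obtain ⟨l, _, _, g, _⟩ := b
    obtain rfl : k = l := le_antisymm hba.1 hab.1
    obtain rfl : f = g := funext fun r => le_antisymm (hab.2 r.1 r.2 r.2) (hba.2 r.1 r.2 r.2)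
    rfl
  inf := PluckerIndex.inf
  sup := PluckerIndex.sup
  inf_le_left a b := by
    rw [le_def]
    refine ⟨le_max_left _ _, fun r h1 h2 => ?_⟩
    simp only [PluckerIndex.inf]
    split_ifs <;> simp
  inf_le_right a b := by
    rw [le_def]
    refine ⟨le_max_right _ _, fun r h1 h2 => ?_⟩
    simp only [PluckerIndex.inf]
    split_ifs <;> simp
  le_inf a b c hab hac := by
    rw [le_def] at *
    refine ⟨max_le hab.1 hac.1, fun r h1 h2 => ?_⟩
    simp only [PluckerIndex.inf]
    split_ifs with h3 h4
    · exact le_min (hab.2 r h1 h3) (hac.2 r h1 h4)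
    · exact hab.2 r h1 h3
    · exact hac.2 r h1 _
  le_sup_left a b := by
    rw [le_def]
    exact ⟨min_le_left _ _, fun r h1 h2 => le_max_left _ _⟩
  le_sup_right a b := by
    rw [le_def]
    exact ⟨min_le_right _ _, fun r h1 h2 => le_max_right _ _⟩
  sup_le a b c hac hbc := by
    rw [le_def] at *
    exact ⟨le_min hac.1 hbc.1, fun r h1 h2 =>
      max_le (hac.2 r (h2.trans_le hac.1) h2) (hbc.2 r (h2.trans_le hbc.1) h2)⟩
  le_sup_inf a b c := by
    change PluckerIndex.inf (PluckerIndex.sup a b) (PluckerIndex.sup a c) ≤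
      PluckerIndex.sup a (PluckerIndex.inf b c)
    rw [le_def]
    refine ⟨?_, fun r h1 h2 => ?_⟩
    · simp only [PluckerIndex.inf, PluckerIndex.sup]; omega
    · simp only [PluckerIndex.inf, PluckerIndex.sup, Fin.castLE_mk] at h1 h2 ⊢
      grind

end PluckerIndex

/-- The ideal of Plücker relations of the variety of complete flags in `ℂⁿ`: all polynomial
relations between the minors of a generic `n × n` matrix `(z_{i,j})` which send `X_{i₁,…,i_k}` to
the minor formed by the rows `1, …, k` and the columns `i₁, …, i_k`. -/
def pluckerIdeal (n : ℕ) : Ideal (MvPolynomial (PluckerIndex n) ℂ) :=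
  RingHom.ker (MvPolynomial.aeval fun a : PluckerIndex n =>
    Matrix.det (Matrix.of fun r s : Fin a.len =>
      (MvPolynomial.X (Fin.castLE a.len_lt.le r, a.entry s) : MvPolynomial (Fin n × Fin n) ℂ)) :
    MvPolynomial (PluckerIndex n) ℂ →ₐ[ℂ] MvPolynomial (Fin n × Fin n) ℂ)

/-! ### Facets -/

/-- `F` is a facet of the polyhedron `C`: a nonempty face (the set where some linear functional
attains its maximum on `C`) whose dimension is one less than that of `C`. -/
def IsFacet {V : Type*} [AddCommGroup V] [Module ℝ V] [TopologicalSpace V] (F C : Set V) : Prop :=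
  F.Nonempty ∧ IsExposed ℝ C F ∧
    Module.finrank ℝ (vectorSpan ℝ F) + 1 = Module.finrank ℝ (vectorSpan ℝ C)

end

/-!
Let `I` be the Plücker ideal. If `C(I, I^m)` is nonempty, the standard monomials (those supported on
chains) form a basis of the quotient by `I`, so every product `X a * X b` with `a`, `b` incomparable
has a normal form modulo `I`. Each term `q` of this form gives a linear inequality
`w a + w b ≤ (w, q)`; these inequalities cut out the closed cone of `I^m`, and a facet of it is the
set where one of them is an equality.

The closed Hibi cone is the set of valuations `w a + w b = w (a ⊓ b) + w (a ⊔ b)` which satisfy the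
inequalities of all other terms. So if `q` is the Hibi term `X (a ⊓ b) * X (a ⊔ b)`, then the facet
contains the Hibi cone. Otherwise `q` is `X c * X d` with `c < a ⊓ b` and `a ⊔ b ≤ d`. Let `w` be an
inner point of the facet, and let `e ∈ [c, d]` be different from `a` and `b`. If `a` and `e` were
incomparable, then comparing the two normal forms of `X a * X b * X e` in weight `w` would show that
an inequality of `X a * X e` is tight at `w` too. So every such `e` is comparable to `a` and `b`,
which forces `a ⊓ b` to differ from `c` by a single box.

Valuations are sums over lattice paths: `w a = ∑ t, G t (a.count (t + 1))` for some `G`. The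
inequality with `a ⊓ b` and `c` differing by one box only says that `G s` is convex at one place
`m`. A `G` which is strictly convex except at this place is then an inner point of a facet of the
Hibi cone.
-/

noncomputable section

section Filtration

open MvPolynomial
open Finsupp (weight)

variable {σ τ : Type*} {w : σ → ℝ} {μ ν : ℝ} {p q : MvPolynomial σ ℂ}

/-- The polynomials all of whose terms have `w`-weight at least `μ`. On them, taking the component
of weight `μ` is a linear substitute for `initialPart`; it vanishes when every term is heavier. -/
def weightFiltration (w : σ → ℝ) (μ : ℝ) : Submodule ℂ (MvPolynomial σ ℂ) :=
  restrictSupport ℂ {e | μ ≤ weight w e}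

theorem mem_weightFiltration :
    p ∈ weightFiltration w μ ↔ ∀ e ∈ p.support, μ ≤ weight w e :=
  mem_restrictSupport_iff ℂ

theorem monomial_mem_weightFiltration (w : σ → ℝ) (d : σ →₀ ℕ) (c : ℂ) :
    monomial d c ∈ weightFiltration w (weight w d) :=
  (monomial_mem_restrictSupport ℂ).2 (Or.inl (le_refl (weight w d)))

theorem weightFiltration_antitone (w : σ → ℝ) : Antitone (weightFiltration w) :=
  fun _ _ h => restrictSupport_mono ℂ fun _ he => h.trans he

theorem mul_mem_weightFiltration (hp : p ∈ weightFiltration w μ) (hq : q ∈ weightFiltration w ν) :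
    p * q ∈ weightFiltration w (μ + ν) := by
  refine restrictSupport_mono ℂ ?_ ((restrictSupport_add ℂ _ _).ge (Submodule.mul_mem_mul hp hq))
  rintro _ ⟨d, hd, e, he, rfl⟩
  have hd : μ ≤ weight w d := hd
  have he : ν ≤ weight w e := he
  exact (add_le_add hd he).trans_eq (map_add _ _ _).symm

theorem weightedHomogeneousComponent_monomial_same (w : σ → ℝ) (d : σ →₀ ℕ) (c : ℂ) :
    weightedHomogeneousComponent w (weight w d) (monomial d c) = monomial d c :=
  (isWeightedHomogeneous_monomial w d c rfl).weightedHomogeneousComponent_same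

theorem weightedHomogeneousComponent_of_lt (hμ : μ < ν) (hp : p ∈ weightFiltration w ν) :
    weightedHomogeneousComponent w μ p = 0 :=
  weightedHomogeneousComponent_eq_zero' _ _ fun e he =>
    (hμ.trans_le (mem_weightFiltration.1 hp e he)).ne'

theorem lt_weight_of_component_eq_zero (hp : p ∈ weightFiltration w μ)
    (h0 : weightedHomogeneousComponent w μ p = 0) {e : σ →₀ ℕ} (he : e ∈ p.support) :
    μ < weight w e := by
  classical
  refine (mem_weightFiltration.1 hp e he).lt_of_ne fun h => mem_support_iff.1 he ?_
  rw [← coeff_zero e, ← h0, coeff_weightedHomogeneousComponent, if_pos h.symm]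

theorem exists_add_of_mem_support_monomial_mul {m u : σ →₀ ℕ} {c : ℂ}
    (hm : m ∈ (monomial u c * p).support) : ∃ q ∈ p.support, u + q = m := by
  rw [mem_support_iff, coeff_monomial_mul', ite_ne_right_iff] at hm
  exact ⟨m - u, mem_support_iff.2 (right_ne_zero_of_mul hm.2), add_tsub_cancel_of_le hm.1⟩

theorem weightedHomogeneousComponent_eq_monomial_iff {m : σ →₀ ℕ} {c : ℂ} (hc : c ≠ 0) :
    weightedHomogeneousComponent w μ p = monomial m c ↔
      coeff m p = c ∧ weight w m = μ ∧ ∀ q ∈ p.support, q ≠ m → weight w q ≠ μ := by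
  classical
  simp only [MvPolynomial.ext_iff, coeff_weightedHomogeneousComponent, coeff_monomial]
  refine ⟨fun h => ?_, fun ⟨h_coeff, hm, h_ne⟩ q => ?_⟩
  · have hm := h m
    rw [if_pos rfl] at hm
    obtain ⟨h_weight, -⟩ := ite_ne_right_iff.1 (hm.trans_ne hc)
    refine ⟨by rwa [if_pos h_weight] at hm, h_weight, fun q hq h_ne hq' => ?_⟩
    have hq0 := h q
    rw [if_pos hq', if_neg h_ne.symm] at hq0
    exact mem_support_iff.1 hq hq0
  · obtain rfl | hq := eq_or_ne m q
    · rw [if_pos hm, if_pos rfl, h_coeff]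
    · rw [if_neg hq, ite_eq_right_iff]
      exact fun h => notMem_support_iff.1 fun hq' => h_ne q hq' hq.symm h

/-- Reduces to monomials: the weights of two terms of `p` and `q` add up to `μ + ν` only if they
are `μ` and `ν`. -/
theorem weightedHomogeneousComponent_mul (hp : p ∈ weightFiltration w μ)
    (hq : q ∈ weightFiltration w ν) : weightedHomogeneousComponent w (μ + ν) (p * q) =
      weightedHomogeneousComponent w μ p * weightedHomogeneousComponent w ν q := by
  rw [p.as_sum, q.as_sum, Finset.sum_mul_sum]
  simp only [map_sum, Finset.sum_mul_sum]
  refine Finset.sum_congr rfl fun d hd => Finset.sum_congr rfl fun e he => ?_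
  have hd' := mem_weightFiltration.1 hp d hd
  have he' := mem_weightFiltration.1 hq e he
  rcases hd'.eq_or_lt with rfl | hlt
  · rcases he'.eq_or_lt with rfl | hlt
    · simp only [weightedHomogeneousComponent_monomial_same, monomial_mul, ← map_add]
    · rw [weightedHomogeneousComponent_of_lt hlt (monomial_mem_weightFiltration _ _ _), mul_zero]
      exact weightedHomogeneousComponent_of_lt (add_lt_add_right hlt _)
        (mul_mem_weightFiltration (monomial_mem_weightFiltration _ _ _)
          (monomial_mem_weightFiltration _ _ _))
  · rw [weightedHomogeneousComponent_of_lt hlt (monomial_mem_weightFiltration _ _ _), zero_mul]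
    exact weightedHomogeneousComponent_of_lt (add_lt_add_of_lt_of_le hlt he')
      (mul_mem_weightFiltration (monomial_mem_weightFiltration _ _ _)
        (monomial_mem_weightFiltration _ _ _))

section Substitution

variable {f : τ → ℝ} {g : σ → MvPolynomial τ ℂ}

theorem pow_mem_weightFiltration (hp : p ∈ weightFiltration w μ) (k : ℕ) :
    p ^ k ∈ weightFiltration w (k • μ) ∧ weightedHomogeneousComponent w (k • μ) (p ^ k) =
      weightedHomogeneousComponent w μ p ^ k := by
  induction k with
  | zero =>
    simpa only [zero_smul, pow_zero, map_zero, monomial_zero', C_1] using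
      And.intro (monomial_mem_weightFiltration w 0 1)
        (weightedHomogeneousComponent_monomial_same w 0 1)
  | succ k ih =>
    simp only [pow_succ, succ_nsmul]
    exact ⟨mul_mem_weightFiltration ih.1 hp, by
      rw [weightedHomogeneousComponent_mul ih.1 hp, ih.2]⟩

theorem aeval_monomial_mem_weightFiltration (hg : ∀ a, g a ∈ weightFiltration f (w a))
    (m : σ →₀ ℕ) : aeval g (monomial m (1 : ℂ)) ∈ weightFiltration f (weight w m) ∧
      weightedHomogeneousComponent f (weight w m) (aeval g (monomial m (1 : ℂ))) =
        aeval (fun a => weightedHomogeneousComponent f (w a) (g a)) (monomial m (1 : ℂ)) := by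
  induction m using Finsupp.induction_linear with
  | zero =>
    simpa only [map_zero, monomial_zero', C_1, map_one] using
      And.intro (monomial_mem_weightFiltration f 0 1)
        (weightedHomogeneousComponent_monomial_same f 0 1)
  | add m m' hm hm' =>
    rw [← one_mul (1 : ℂ), ← monomial_mul, map_mul (aeval g), map_add]
    exact ⟨mul_mem_weightFiltration hm.1 hm'.1, by
      rw [weightedHomogeneousComponent_mul hm.1 hm'.1, hm.2, hm'.2, map_mul]⟩
  | single a k =>
    simpa only [← X_pow_eq_monomial, map_pow, aeval_X, Finsupp.weight_single] using
      pow_mem_weightFiltration (hg a) k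

theorem weightedHomogeneousComponent_aeval (hg : ∀ a, g a ∈ weightFiltration f (w a))
    (hp : p ∈ weightFiltration w μ) : weightedHomogeneousComponent f μ (aeval g p) =
      aeval (fun a => weightedHomogeneousComponent f (w a) (g a))
        (weightedHomogeneousComponent w μ p) := by
  rw [p.as_sum]
  simp only [map_sum]
  refine Finset.sum_congr rfl fun m hm => ?_
  rw [← mul_one (coeff m p), ← smul_eq_mul, ← smul_monomial]
  simp only [map_smul]
  obtain ⟨h_mem, h_comp⟩ := aeval_monomial_mem_weightFiltration hg m
  rcases (mem_weightFiltration.1 hp m hm).eq_or_lt with rfl | hlt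
  · rw [h_comp, weightedHomogeneousComponent_monomial_same]
  · rw [weightedHomogeneousComponent_of_lt hlt h_mem,
      weightedHomogeneousComponent_of_lt hlt (monomial_mem_weightFiltration w m 1), map_zero]

end Substitution

end Filtration

section InitialSpan

open MvPolynomial
open Finsupp (weight)

variable {σ : Type*} {w : σ → ℝ} {μ : ℝ} {p q : MvPolynomial σ ℂ} {I : Ideal (MvPolynomial σ ℂ)}

theorem initialPart_eq_weightedHomogeneousComponent (hp : p ∈ weightFiltration w μ)
    (h0 : weightedHomogeneousComponent w μ p ≠ 0) :
    initialPart w p = weightedHomogeneousComponent w μ p := by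
  classical
  obtain ⟨m, hm⟩ := ne_zero_iff.1 h0
  rw [coeff_weightedHomogeneousComponent, ite_ne_right_iff, ← mem_support_iff] at hm
  rw [initialPart, weightedHomogeneousComponent_apply]
  refine Finset.sum_congr (Finset.filter_congr fun d hd => ⟨fun hmin => ?_, ?_⟩) fun _ _ => rfl
  · exact ((hmin m hm.2).trans hm.1.le).antisymm (mem_weightFiltration.1 hp d hd)
  · rintro rfl
    exact mem_weightFiltration.1 hp

theorem exists_weightedHomogeneousComponent_ne_zero (w : σ → ℝ) (hp : p ≠ 0) :
    ∃ μ, p ∈ weightFiltration w μ ∧ weightedHomogeneousComponent w μ p ≠ 0 := by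
  classical
  obtain ⟨m, hm, hmin⟩ := p.support.exists_min_image (weight w) (support_nonempty.2 hp)
  refine ⟨weight w m, mem_weightFiltration.2 hmin, ne_zero_iff.2 ⟨m, ?_⟩⟩
  rw [coeff_weightedHomogeneousComponent, if_pos rfl]
  exact mem_support_iff.1 hm

theorem exists_initialPart_eq (w : σ → ℝ) (p : MvPolynomial σ ℂ) :
    ∃ μ, p ∈ weightFiltration w μ ∧ initialPart w p = weightedHomogeneousComponent w μ p := by
  by_cases hp : p = 0
  · exact ⟨0, hp ▸ Submodule.zero_mem _, by simp [hp, initialPart]⟩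
  · obtain ⟨μ, hmem, h0⟩ := exists_weightedHomogeneousComponent_ne_zero w hp
    exact ⟨μ, hmem, initialPart_eq_weightedHomogeneousComponent hmem h0⟩

theorem initialPart_mem_initialSpan (w : σ → ℝ) (hp : p ∈ I) :
    initialPart w p ∈ initialSpan w I :=
  Submodule.subset_span ⟨p, hp, rfl⟩

theorem weightedHomogeneousComponent_mem_initialSpan (hpI : p ∈ I)
    (hp : p ∈ weightFiltration w μ) : weightedHomogeneousComponent w μ p ∈ initialSpan w I := by
  by_cases h0 : weightedHomogeneousComponent w μ p = 0
  · exact h0 ▸ Submodule.zero_mem _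
  · exact initialPart_eq_weightedHomogeneousComponent hp h0 ▸ initialPart_mem_initialSpan w hpI

theorem exists_lift_of_mem_initialSpan (hq : q ∈ initialSpan w I) (μ : ℝ) :
    ∃ p ∈ I, p ∈ weightFiltration w μ ∧
      weightedHomogeneousComponent w μ p = weightedHomogeneousComponent w μ q := by
  induction hq using Submodule.span_induction with
  | mem q hq =>
    obtain ⟨p, hpI, rfl⟩ := hq
    obtain ⟨ν, hp, h_initial⟩ := exists_initialPart_eq w p
    rw [h_initial]
    have h_hom := weightedHomogeneousComponent_isWeightedHomogeneous (w := w) ν p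
    by_cases hμ : μ = ν
    · subst hμ
      exact ⟨p, hpI, hp, h_hom.weightedHomogeneousComponent_same.symm⟩
    · exact ⟨0, I.zero_mem, Submodule.zero_mem _, by
        rw [map_zero, h_hom.weightedHomogeneousComponent_ne μ hμ]⟩
  | zero => exact ⟨0, I.zero_mem, Submodule.zero_mem _, rfl⟩
  | add q q' _ _ hq hq' =>
    obtain ⟨p, hpI, hp, h⟩ := hq
    obtain ⟨p', hpI', hp', h'⟩ := hq'
    exact ⟨p + p', I.add_mem hpI hpI', Submodule.add_mem _ hp hp', by rw [map_add, map_add, h, h']⟩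
  | smul c q _ hq =>
    obtain ⟨p, hpI, hp, h⟩ := hq
    exact ⟨c • p, Submodule.smul_of_tower_mem I c hpI, Submodule.smul_mem _ c hp, by
      rw [map_smul, map_smul, h]⟩

theorem mul_mem_initialSpan (p : MvPolynomial σ ℂ) (hq : q ∈ initialSpan w I) :
    p * q ∈ initialSpan w I := by
  induction p using MvPolynomial.induction_on' with
  | add p p' hp hp' => exact add_mul p p' q ▸ Submodule.add_mem _ hp hp'
  | monomial d c =>
    induction hq using Submodule.span_induction with
    | mem q hq =>
      obtain ⟨r, hrI, rfl⟩ := hq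
      obtain ⟨ν, hr, h_initial⟩ := exists_initialPart_eq w r
      have hd := monomial_mem_weightFiltration w d c
      rw [h_initial, ← weightedHomogeneousComponent_monomial_same w,
        ← weightedHomogeneousComponent_mul hd hr]
      exact weightedHomogeneousComponent_mem_initialSpan (I.mul_mem_left _ hrI)
        (mul_mem_weightFiltration hd hr)
    | zero => exact (mul_zero (monomial d c)).symm ▸ Submodule.zero_mem _
    | add q q' _ _ hq hq' => exact mul_add _ q q' ▸ Submodule.add_mem _ hq hq'
    | smul a q _ hq => exact mul_smul_comm a _ q ▸ Submodule.smul_mem _ a hq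

theorem span_le_initialSpan {s : Set (MvPolynomial σ ℂ)} (hs : s ⊆ initialSpan w I) :
    (Ideal.span s).restrictScalars ℂ ≤ initialSpan w I := by
  intro p hp
  induction hp using Submodule.span_induction with
  | mem q hq => exact hs hq
  | zero => exact Submodule.zero_mem _
  | add q q' _ _ hq hq' => exact Submodule.add_mem _ hq hq'
  | smul r q _ hq => exact mul_mem_initialSpan r hq

end InitialSpan

section StandardMonomials

open MvPolynomial
open Finsupp (weight)

variable {σ M : Type*} [AddCommMonoid M] {deg : σ → M} {w w₀ : σ → ℝ}
  {I : Ideal (MvPolynomial σ ℂ)} {B : Set (σ →₀ ℕ)}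

/-- The span of the monomials which are divisible by none of the monomials with exponents in `B`,
the standard monomials. -/
def standardSpan (B : Set (σ →₀ ℕ)) : Submodule ℂ (MvPolynomial σ ℂ) :=
  restrictSupport ℂ {m | ∀ b ∈ B, ¬ b ≤ m}

theorem mem_standardSpan {p : MvPolynomial σ ℂ} :
    p ∈ standardSpan B ↔ ∀ m ∈ p.support, ∀ b ∈ B, ¬ b ≤ m :=
  mem_restrictSupport_iff ℂ

theorem weightedHomogeneousComponent_mem_restrictSupport {s : Set (σ →₀ ℕ)}
    {p : MvPolynomial σ ℂ} (hp : p ∈ restrictSupport ℂ s) (f : σ → M) (d : M) :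
    weightedHomogeneousComponent f d p ∈ restrictSupport ℂ s := by
  classical
  refine (mem_restrictSupport_iff ℂ).2 fun m hm => (mem_restrictSupport_iff ℂ).1 hp ?_
  rw [Finset.mem_coe, mem_support_iff, coeff_weightedHomogeneousComponent] at hm
  exact mem_support_iff.2 (ite_ne_right_iff.1 hm).2

theorem wellFounded_heavier (hfin : ∀ d : M, {m : σ →₀ ℕ | weight deg m = d}.Finite) (w : σ → ℝ) :
    WellFounded fun m' m : σ →₀ ℕ => weight deg m' = weight deg m ∧ weight w m < weight w m' := by
  rw [wellFounded_iff_isEmpty_descending_chain]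
  refine ⟨fun ⟨m, hm⟩ => ?_⟩
  have h_deg (k : ℕ) : weight deg (m k) = weight deg (m 0) := by
    induction k with
    | zero => rfl
    | succ k ih => exact (hm k).1.trans ih
  have h_weight : StrictMono fun k => weight w (m k) := strictMono_nat_of_lt_succ fun k => (hm k).2
  exact Set.infinite_range_of_injective (f := m) (h_weight.injective.of_comp (f := weight w))
    ((hfin (weight deg (m 0))).subset (Set.range_subset_iff.2 h_deg))

theorem sup_standardSpan_eq_top (hfin : ∀ d : M, {m : σ →₀ ℕ | weight deg m = d}.Finite)
    {N : Submodule ℂ (MvPolynomial σ ℂ)}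
    (hN : ∀ m, (∃ b ∈ B, b ≤ m) → ∃ p ∈ N, monomial m 1 - p ∈
      restrictSupport ℂ {e | weight deg e = weight deg m ∧ weight w₀ m < weight w₀ e}) :
    N ⊔ standardSpan B = ⊤ := by
  have h_monomial (m : σ →₀ ℕ) : monomial m (1 : ℂ) ∈ N ⊔ standardSpan B := by
    induction m using (wellFounded_heavier hfin w₀).induction with
    | _ m ih =>
    by_cases hm : ∃ b ∈ B, b ≤ m
    · obtain ⟨p, hp, h_heavier⟩ := hN m hm
      rw [restrictSupport_eq_span] at h_heavier
      rw [← add_sub_cancel p (monomial m (1 : ℂ))]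
      refine Submodule.add_mem _ (Submodule.mem_sup_left hp)
        (Submodule.span_le.2 ?_ h_heavier)
      rintro _ ⟨e, he, rfl⟩
      exact ih e he
    · push Not at hm
      exact Submodule.mem_sup_right ((monomial_mem_restrictSupport ℂ).2 (Or.inl hm))
  rw [eq_top_iff, ← restrictSupport_univ, restrictSupport_eq_span, Submodule.span_le]
  rintro _ ⟨m, -, rfl⟩
  exact h_monomial m

/-- The ideal generated by the monomials with exponents in `B`. -/
def monomialIdeal (B : Set (σ →₀ ℕ)) : Ideal (MvPolynomial σ ℂ) :=
  Ideal.span ((fun b => monomial b 1) '' B)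

theorem mem_monomialIdeal {p : MvPolynomial σ ℂ} :
    p ∈ monomialIdeal B ↔ ∀ m ∈ p.support, ∃ b ∈ B, b ≤ m :=
  mem_ideal_span_monomial_image

theorem mem_groebnerCone {J : Ideal (MvPolynomial σ ℂ)} :
    w ∈ groebnerCone I J ↔ initialSpan w I = J.restrictScalars ℂ :=
  Iff.rfl

theorem initialPart_mem_of_mem_groebnerCone {J : Ideal (MvPolynomial σ ℂ)}
    (hw : w ∈ groebnerCone I J) {p : MvPolynomial σ ℂ} (hp : p ∈ I) : initialPart w p ∈ J :=
  (mem_groebnerCone.1 hw).le (initialPart_mem_initialSpan w hp)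

theorem disjoint_standardSpan_of_mem_groebnerCone (hw₀ : w₀ ∈ groebnerCone I (monomialIdeal B)) :
    Disjoint (I.restrictScalars ℂ) (standardSpan B) := by
  refine Submodule.disjoint_def.2 fun p hpI hp => ?_
  by_contra hp0
  obtain ⟨μ, hμ, h0⟩ := exists_weightedHomogeneousComponent_ne_zero w₀ hp0
  obtain ⟨m, hm⟩ := support_nonempty.2 h0
  have h_initial := initialPart_mem_of_mem_groebnerCone hw₀ hpI
  rw [initialPart_eq_weightedHomogeneousComponent hμ h0] at h_initial
  obtain ⟨b, hb, hbm⟩ := mem_monomialIdeal.1 h_initial m hm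
  exact mem_standardSpan.1 (weightedHomogeneousComponent_mem_restrictSupport hp w₀ μ) m hm b hb hbm

theorem isCompl_standardSpan (hfin : ∀ d : M, {m : σ →₀ ℕ | weight deg m = d}.Finite)
    (hI : ∀ p ∈ I, ∀ d, weightedHomogeneousComponent deg d p ∈ I)
    (hw₀ : w₀ ∈ groebnerCone I (monomialIdeal B)) :
    IsCompl (I.restrictScalars ℂ) (standardSpan B) := by
  classical
  refine ⟨disjoint_standardSpan_of_mem_groebnerCone hw₀, codisjoint_iff.2 <|
    sup_standardSpan_eq_top (w₀ := w₀) hfin fun m hm => ?_⟩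
  have h_mem : monomial m (1 : ℂ) ∈ initialSpan w₀ I := by
    refine (mem_groebnerCone.1 hw₀).ge (mem_monomialIdeal.2 fun e he => ?_)
    rwa [Finset.mem_singleton.1 (support_monomial_subset he)]
  obtain ⟨p, hpI, hp, h_comp⟩ := exists_lift_of_mem_initialSpan h_mem (weight w₀ m)
  have hm_fil := monomial_mem_weightFiltration w₀ m 1
  refine ⟨weightedHomogeneousComponent deg (weight deg m) p, hI p hpI _,
    (mem_restrictSupport_iff ℂ).2 fun e he => ?_⟩
  rw [← (isWeightedHomogeneous_monomial deg m (1 : ℂ) rfl).weightedHomogeneousComponent_same,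
    ← map_sub, Finset.mem_coe, mem_support_iff, coeff_weightedHomogeneousComponent,
    ite_ne_right_iff, ← mem_support_iff] at he
  exact ⟨he.1, lt_weight_of_component_eq_zero (Submodule.sub_mem _ hm_fil hp)
    (by rw [map_sub, h_comp, sub_self]) he.2⟩

end StandardMonomials

section NormalForm

open MvPolynomial
open Finsupp (weight)

variable {σ M : Type*} [AddCommMonoid M] {deg : σ → M} {w w₀ : σ → ℝ}
  {I : Ideal (MvPolynomial σ ℂ)} {B : Set (σ →₀ ℕ)} {p q : MvPolynomial σ ℂ}

/-- The normal form of a polynomial modulo `I`: the linear combination of standard monomials to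
which it is congruent. -/
def normalForm (hc : IsCompl (I.restrictScalars ℂ) (standardSpan B)) :
    MvPolynomial σ ℂ →ₗ[ℂ] MvPolynomial σ ℂ :=
  (standardSpan B).projection _ hc.symm

/-- The straightening relation of `m`: the element of `I` which rewrites the monomial with
exponent `m` in terms of standard monomials. -/
def straightening (hc : IsCompl (I.restrictScalars ℂ) (standardSpan B)) (m : σ →₀ ℕ) :
    MvPolynomial σ ℂ :=
  monomial m 1 - normalForm hc (monomial m 1)

variable (hc : IsCompl (I.restrictScalars ℂ) (standardSpan B))

theorem normalForm_mem_standardSpan (p : MvPolynomial σ ℂ) : normalForm hc p ∈ standardSpan B :=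
  Submodule.projection_apply_mem _ _

theorem sub_normalForm_mem (p : MvPolynomial σ ℂ) : p - normalForm hc p ∈ I :=
  Submodule.sub_projection_mem hc.symm p

theorem normalForm_of_mem_standardSpan (hp : p ∈ standardSpan B) : normalForm hc p = p :=
  Submodule.projection_apply_of_mem_left _ hp

theorem normalForm_of_mem (hp : p ∈ I) : normalForm hc p = 0 :=
  (Submodule.projection_apply_eq_zero_iff hc.symm).2 hp

theorem normalForm_eq_of_sub_mem (h : p - q ∈ I) : normalForm hc p = normalForm hc q := by
  rw [← sub_eq_zero, ← map_sub, normalForm_of_mem hc h]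

theorem straightening_mem (m : σ →₀ ℕ) : straightening hc m ∈ I :=
  sub_normalForm_mem hc _

theorem notMem_support_normalForm {b : σ →₀ ℕ} (hb : b ∈ B) (p : MvPolynomial σ ℂ) :
    b ∉ (normalForm hc p).support :=
  fun h => mem_standardSpan.1 (normalForm_mem_standardSpan hc p) b h b hb le_rfl

theorem coeff_straightening_self {b : σ →₀ ℕ} (hb : b ∈ B) : coeff b (straightening hc b) = 1 := by
  classical
  rw [straightening, coeff_sub, coeff_monomial, if_pos rfl,
    notMem_support_iff.1 (notMem_support_normalForm hc hb _), sub_zero]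

theorem normalForm_monomial_mul (u : σ →₀ ℕ) (p : MvPolynomial σ ℂ) :
    normalForm hc (monomial u 1 * p) = normalForm hc (monomial u 1 * normalForm hc p) :=
  normalForm_eq_of_sub_mem hc <| mul_sub (monomial u (1 : ℂ)) p (normalForm hc p) ▸
    I.mul_mem_left _ (sub_normalForm_mem hc p)

theorem weight_eq_of_mem_support_normalForm
    (hI : ∀ p ∈ I, ∀ d, weightedHomogeneousComponent deg d p ∈ I) {m e : σ →₀ ℕ}
    (he : e ∈ (normalForm hc (monomial m 1)).support) : weight deg e = weight deg m := by
  have h_hom : weightedHomogeneousComponent deg (weight deg m) (normalForm hc (monomial m 1)) =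
      normalForm hc (monomial m 1) := by
    rw [← normalForm_of_mem_standardSpan hc (weightedHomogeneousComponent_mem_restrictSupport
      (normalForm_mem_standardSpan hc _) deg _)]
    refine (normalForm_eq_of_sub_mem hc ?_).symm
    have h_mem := hI _ (sub_normalForm_mem hc (monomial m 1)) (weight deg m)
    rwa [map_sub,
      (isWeightedHomogeneous_monomial deg m (1 : ℂ) rfl).weightedHomogeneousComponent_same] at h_mem
  rw [← h_hom] at he
  exact weightedHomogeneousComponent_isWeightedHomogeneous _ _ (mem_support_iff.1 he)

end NormalForm

section LimitWeights

open MvPolynomial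
open Finsupp (weight)

variable {σ M : Type*} [AddCommMonoid M] {deg : σ → M} {w w₀ : σ → ℝ}
  {I : Ideal (MvPolynomial σ ℂ)} {B : Set (σ →₀ ℕ)} {p : MvPolynomial σ ℂ} {μ : ℝ}
  (hfin : ∀ d : M, {m : σ →₀ ℕ | weight deg m = d}.Finite)
  (hI : ∀ p ∈ I, ∀ d, weightedHomogeneousComponent deg d p ∈ I)
  (hc : IsCompl (I.restrictScalars ℂ) (standardSpan B))

theorem support_straightening_subset {b m : σ →₀ ℕ} (hm : m ∈ (straightening hc b).support) :
    m = b ∨ m ∈ (normalForm hc (monomial b 1)).support := by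
  classical
  refine (Finset.mem_union.1 (support_sub σ _ _ hm)).imp_left fun h => ?_
  exact Finset.mem_singleton.1 (support_monomial_subset h)

theorem mem_support_straightening {b q : σ →₀ ℕ} (hb : b ∈ B)
    (hq : q ∈ (normalForm hc (monomial b 1)).support) : q ∈ (straightening hc b).support := by
  classical
  have h_ne : b ≠ q := by
    rintro rfl
    exact notMem_support_normalForm hc hb _ hq
  rw [mem_support_iff, straightening, coeff_sub, coeff_monomial, if_neg h_ne, zero_sub]
  exact neg_ne_zero.2 (mem_support_iff.1 hq)

theorem lt_weight_of_mem_groebnerCone (hw : w ∈ groebnerCone I (monomialIdeal B)) {b q : σ →₀ ℕ}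
    (hb : b ∈ B) (hq : q ∈ (normalForm hc (monomial b 1)).support) : weight w b < weight w q := by
  classical
  have h_mem_b : b ∈ (straightening hc b).support := by
    rw [mem_support_iff, coeff_straightening_self hc hb]
    exact one_ne_zero
  obtain ⟨μ, hμ, h0⟩ := exists_weightedHomogeneousComponent_ne_zero w (ne_zero_iff.2
    ⟨b, mem_support_iff.1 h_mem_b⟩)
  have h_initial := initialPart_mem_of_mem_groebnerCone hw (straightening_mem hc b)
  rw [initialPart_eq_weightedHomogeneousComponent hμ h0, mem_monomialIdeal] at h_initial
  have h_eq {m : σ →₀ ℕ}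
      (hm : m ∈ (weightedHomogeneousComponent w μ (straightening hc b)).support) :
      m = b ∧ weight w m = μ := by
    obtain ⟨b', hb', h_le⟩ := h_initial m hm
    rw [mem_support_iff, coeff_weightedHomogeneousComponent, ite_ne_right_iff,
      ← mem_support_iff] at hm
    exact ⟨(support_straightening_subset hc hm.2).resolve_right fun h =>
      mem_standardSpan.1 (normalForm_mem_standardSpan hc _) m h b' hb' h_le, hm.1⟩
  obtain ⟨m, hm⟩ := support_nonempty.2 h0
  obtain ⟨rfl, rfl⟩ := h_eq hm
  have hq' := mem_support_straightening hc hb hq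
  refine (mem_weightFiltration.1 hμ q hq').lt_of_ne fun h => ?_
  obtain rfl : q = m := (h_eq (by
    rwa [mem_support_iff, coeff_weightedHomogeneousComponent, if_pos h.symm,
      ← mem_support_iff])).1
  exact notMem_support_normalForm hc hb _ hq

section

variable (hw₀ : w₀ ∈ groebnerCone I (monomialIdeal B))
  (hw : ∀ b ∈ B, normalForm hc (monomial b 1) ∈ weightFiltration w (weight w b))

include hfin hI hw₀ hw

theorem normalForm_monomial_mem_weightFiltration (m : σ →₀ ℕ) :
    normalForm hc (monomial m 1) ∈ weightFiltration w (weight w m) := by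
  induction m using (wellFounded_heavier hfin w₀).induction with
  | _ m ih =>
  by_cases hm : ∃ b ∈ B, b ≤ m
  · obtain ⟨b, hb, hbm⟩ := hm
    obtain ⟨u, rfl⟩ := exists_add_of_le hbm
    rw [add_comm b u, ← one_mul (1 : ℂ), ← monomial_mul, normalForm_monomial_mul]
    set r := normalForm hc (monomial b 1)
    rw [r.as_sum, Finset.mul_sum, map_sum]
    refine Submodule.sum_mem _ fun q hq => ?_
    rw [monomial_mul, one_mul, ← mul_one (coeff q r), ← smul_eq_mul, ← smul_monomial, map_smul]
    have h_weight : weight w (u + b) ≤ weight w (u + q) := by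
      simpa only [map_add, add_le_add_iff_left] using mem_weightFiltration.1 (hw b hb) q hq
    refine Submodule.smul_mem _ _ (weightFiltration_antitone w h_weight (ih (u + q) ⟨?_, ?_⟩))
    · rw [map_add, map_add, weight_eq_of_mem_support_normalForm hc hI hq, add_comm]
    · rw [add_comm b u, map_add, map_add, add_lt_add_iff_left]
      exact lt_weight_of_mem_groebnerCone hc hw₀ hb hq
  · push Not at hm
    rw [normalForm_of_mem_standardSpan hc ((monomial_mem_restrictSupport ℂ).2 (Or.inl hm))]
    exact monomial_mem_weightFiltration w m 1

theorem lt_weight_of_mem_support_normalForm (hp : ∀ m ∈ p.support, μ < weight w m) :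
    ∀ m ∈ (normalForm hc p).support, μ < weight w m := by
  have h_span : p ∈ restrictSupport ℂ {m | μ < weight w m} := (mem_restrictSupport_iff ℂ).2 hp
  suffices normalForm hc p ∈ restrictSupport ℂ {m | μ < weight w m} from
    (mem_restrictSupport_iff ℂ).1 this
  rw [restrictSupport_eq_span] at h_span
  refine (Submodule.span_le (p := (restrictSupport ℂ {m | μ < weight w m}).comap
    (normalForm hc))).2 ?_ h_span
  rintro _ ⟨m, hm, rfl⟩
  exact restrictSupport_mono ℂ (fun e he => lt_of_lt_of_le (b := weight w m) hm he)
    (normalForm_monomial_mem_weightFiltration hfin hI hc hw₀ hw m)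

theorem lt_weight_of_mem_support_normalForm_add {b u : σ →₀ ℕ}
    (hb : ∀ q ∈ (normalForm hc (monomial b 1)).support, μ < weight w (u + q)) :
    ∀ m ∈ (normalForm hc (monomial (u + b) 1)).support, μ < weight w m := by
  rw [← one_mul (1 : ℂ), ← monomial_mul, normalForm_monomial_mul]
  refine lt_weight_of_mem_support_normalForm hfin hI hc hw₀ hw fun m hm => ?_
  obtain ⟨q, hq, rfl⟩ := exists_add_of_mem_support_monomial_mul hm
  exact hb q hq

theorem add_mem_support_normalForm {b q u : σ →₀ ℕ}
    (hq : q ∈ (normalForm hc (monomial b 1)).support) (h_standard : ∀ b' ∈ B, ¬ b' ≤ u + q)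
    (h_other : ∀ q' ∈ (normalForm hc (monomial b 1)).support, q' ≠ q → weight w q < weight w q') :
    u + q ∈ (normalForm hc (monomial (u + b) 1)).support := by
  classical
  set r := normalForm hc (monomial b (1 : ℂ)) with hr
  have h_rest : ∀ m ∈ (normalForm hc (monomial u 1 * (r - monomial q (coeff q r)))).support,
      weight w (u + q) < weight w m := by
    refine lt_weight_of_mem_support_normalForm hfin hI hc hw₀ hw fun m hm => ?_
    obtain ⟨q', hq', rfl⟩ := exists_add_of_mem_support_monomial_mul hm
    have h_ne : q' ≠ q := by
      rintro rfl
      exact mem_support_iff.1 hq' (by rw [coeff_sub, coeff_monomial, if_pos rfl, sub_self])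
    rw [mem_support_iff, coeff_sub, coeff_monomial, if_neg h_ne.symm, sub_zero,
      ← mem_support_iff] at hq'
    rw [map_add, map_add]
    exact add_lt_add_right (h_other q' hq' h_ne) _
  have h_coeff := notMem_support_iff.1 fun h => (h_rest (u + q) h).false
  rw [mul_sub, map_sub, monomial_mul, one_mul, hr, ← normalForm_monomial_mul, ← hr, monomial_mul,
    one_mul, normalForm_of_mem_standardSpan hc ((monomial_mem_restrictSupport ℂ).2
    (Or.inl h_standard)), coeff_sub, coeff_monomial, if_pos rfl, sub_eq_zero] at h_coeff
  exact mem_support_iff.2 (h_coeff.trans_ne (mem_support_iff.1 hq))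

theorem disjoint_initialSpan_standardSpan : Disjoint (initialSpan w I) (standardSpan B) := by
  classical
  refine Submodule.disjoint_def.2 fun q hq hqB => ?_
  by_contra hq0
  obtain ⟨μ, -, h0⟩ := exists_weightedHomogeneousComponent_ne_zero w hq0
  obtain ⟨p, hpI, hp, h_comp⟩ := exists_lift_of_mem_initialSpan hq μ
  obtain ⟨m, hm⟩ := support_nonempty.2 h0
  set q' := weightedHomogeneousComponent w μ q
  have h_hom : q'.IsWeightedHomogeneous w μ :=
    weightedHomogeneousComponent_isWeightedHomogeneous _ _
  have h_heavier : ∀ e ∈ (p - q').support, μ < weight w e := fun e he =>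
    lt_weight_of_component_eq_zero (Submodule.sub_mem _ hp (mem_weightFiltration.2 fun e he =>
      (h_hom (mem_support_iff.1 he)).ge))
      (by rw [map_sub, h_comp, h_hom.weightedHomogeneousComponent_same, sub_self]) he
  have h_neg : normalForm hc (p - q') = -q' := by
    rw [map_sub, normalForm_of_mem hc hpI, zero_sub, normalForm_of_mem_standardSpan hc
      (weightedHomogeneousComponent_mem_restrictSupport hqB w μ)]
  refine (h_hom (mem_support_iff.1 hm)).not_gt
    (lt_weight_of_mem_support_normalForm hfin hI hc hw₀ hw h_heavier m ?_)
  rwa [h_neg, support_neg]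

end

theorem initialPart_straightening {b : σ →₀ ℕ} (hb : b ∈ B)
    (hw : normalForm hc (monomial b 1) ∈ weightFiltration w (weight w b)) :
    initialPart w (straightening hc b) = monomial b 1 -
      weightedHomogeneousComponent w (weight w b) (normalForm hc (monomial b 1)) := by
  classical
  rw [initialPart_eq_weightedHomogeneousComponent
    (p := straightening hc b) (Submodule.sub_mem _ (monomial_mem_weightFiltration w b 1) hw)]
  · rw [straightening, map_sub, weightedHomogeneousComponent_monomial_same]
  · refine ne_zero_iff.2 ⟨b, ?_⟩
    rw [coeff_weightedHomogeneousComponent, if_pos rfl]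
    exact (coeff_straightening_self hc hb).trans_ne one_ne_zero

include hfin hI

/-- The initial ideal lies between the ideal of these initial forms, which already has the
standard monomials as a complement by division, and a complement of the standard monomials. -/
theorem initialSpan_eq_span_initialPart_straightening
    (hw₀ : w₀ ∈ groebnerCone I (monomialIdeal B))
    (hw : ∀ b ∈ B, normalForm hc (monomial b 1) ∈ weightFiltration w (weight w b)) :
    initialSpan w I = (Ideal.span
      ((fun b => initialPart w (straightening hc b)) '' B)).restrictScalars ℂ := by
  classical
  have h_le : (Ideal.span ((fun b => initialPart w (straightening hc b)) '' B)).restrictScalars ℂ ≤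
      initialSpan w I := by
    refine span_le_initialSpan ?_
    rintro _ ⟨b, -, rfl⟩
    exact initialPart_mem_initialSpan w (straightening_mem hc b)
  refine (eq_of_le_of_inf_le_of_sup_le h_le
    ((disjoint_initialSpan_standardSpan hfin hI hc hw₀ hw).eq_bot.le.trans bot_le)
    (le_top.trans_eq (sup_standardSpan_eq_top (w₀ := w₀) hfin fun m hm => ?_).symm)).symm
  obtain ⟨b, hb, hbm⟩ := hm
  obtain ⟨u, rfl⟩ := exists_add_of_le hbm
  refine ⟨monomial u 1 * initialPart w (straightening hc b), Ideal.mul_mem_left _ _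
    (Ideal.subset_span ⟨b, hb, rfl⟩), (mem_restrictSupport_iff ℂ).2 fun e he => ?_⟩
  rw [initialPart_straightening hc hb (hw b hb), mul_sub, monomial_mul, one_mul, add_comm b u,
    sub_sub_cancel, Finset.mem_coe] at he
  obtain ⟨q, hq, rfl⟩ := exists_add_of_mem_support_monomial_mul he
  rw [mem_support_iff, coeff_weightedHomogeneousComponent, ite_ne_right_iff,
    ← mem_support_iff] at hq
  simp only [Set.mem_ofPred_eq, map_add, add_comm (weight _ b), add_lt_add_iff_left]
  exact ⟨by rw [weight_eq_of_mem_support_normalForm hc hI hq.2],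
    lt_weight_of_mem_groebnerCone hc hw₀ hb hq.2⟩

theorem mem_groebnerCone_monomialIdeal_iff (hw₀ : w₀ ∈ groebnerCone I (monomialIdeal B)) :
    w ∈ groebnerCone I (monomialIdeal B) ↔
      ∀ b ∈ B, ∀ q ∈ (normalForm hc (monomial b 1)).support, weight w b < weight w q := by
  refine ⟨fun hw b hb q hq => lt_weight_of_mem_groebnerCone hc hw hb hq, fun hw => ?_⟩
  have hw_le (b) (hb : b ∈ B) : normalForm hc (monomial b 1) ∈ weightFiltration w (weight w b) :=
    mem_weightFiltration.2 fun q hq => (hw b hb q hq).le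
  rw [mem_groebnerCone, initialSpan_eq_span_initialPart_straightening hfin hI hc hw₀ hw_le,
    monomialIdeal]
  refine congrArg (fun s => (Ideal.span s).restrictScalars ℂ) (Set.image_congr fun b hb => ?_)
  rw [initialPart_straightening hc hb (hw_le b hb), weightedHomogeneousComponent_eq_zero' _ _
    fun q hq => (hw b hb q hq).ne', sub_zero]

end LimitWeights

namespace PluckerIndex

variable {n : ℕ} {a b c d e : PluckerIndex n}

/-- The number of subscripts of `a` which are less than `t`. Viewed as a function of `t`, this is
the lattice path which steps up at the subscripts of `a` and is flat elsewhere. -/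
def count (a : PluckerIndex n) (t : ℕ) : ℕ :=
  (Finset.univ.filter fun r : Fin a.len => (a.entry r).1 < t).card

theorem count_le_len (a : PluckerIndex n) (t : ℕ) : a.count t ≤ a.len :=
  (Finset.card_le_univ _).trans_eq (Fintype.card_fin _)

theorem lt_count_iff (a : PluckerIndex n) (r : Fin a.len) (t : ℕ) :
    r.1 < a.count t ↔ (a.entry r).1 < t := by
  refine ⟨fun h => ?_, fun h => ?_⟩
  · by_contra hr
    rw [count, ← Fin.card_Iio r] at h
    refine h.not_ge (Finset.card_le_card fun s hs => Finset.mem_Iio.2 ?_)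
    exact a.strictMono.lt_iff_lt.1 ((Finset.mem_filter.1 hs).2.trans_le (not_lt.1 hr))
  · rw [← Nat.succ_le_iff, Nat.succ_eq_add_one, ← Fin.card_Iic r]
    refine Finset.card_le_card fun s hs => Finset.mem_filter.2 ⟨Finset.mem_univ s, ?_⟩
    exact (Fin.le_def.1 (a.strictMono.monotone (Finset.mem_Iic.1 hs))).trans_lt h

theorem lt_count_iff_exists (a : PluckerIndex n) (r t : ℕ) :
    r < a.count t ↔ ∃ h : r < a.len, (a.entry ⟨r, h⟩).1 < t :=
  ⟨fun h => ⟨h.trans_le (a.count_le_len t), (a.lt_count_iff ⟨r, _⟩ t).1 h⟩,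
    fun ⟨h, hr⟩ => (a.lt_count_iff ⟨r, h⟩ t).2 hr⟩

@[simp]
theorem count_zero (a : PluckerIndex n) : a.count 0 = 0 := by
  simp [count]

theorem count_of_le (a : PluckerIndex n) {t : ℕ} (ht : n ≤ t) : a.count t = a.len := by
  rw [count, Finset.filter_true_of_mem fun r _ => (a.entry r).2.trans_le ht, Finset.card_univ,
    Fintype.card_fin]

theorem count_mono (a : PluckerIndex n) : Monotone a.count := fun _ _ h =>
  Finset.card_le_card <| Finset.monotone_filter_right _ fun _ _ hr => hr.trans_le h

theorem count_succ (a : PluckerIndex n) (t : ℕ) :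
    a.count (t + 1) = a.count t ∨ a.count (t + 1) = a.count t + 1 := by
  have h_mono := a.count_mono (Nat.le_add_right t 1)
  by_contra! h
  obtain ⟨h_len, h_lt⟩ := (a.lt_count_iff_exists (a.count t + 1) (t + 1)).1 (by omega)
  have h_le := mt (a.lt_count_iff ⟨a.count t, by omega⟩ t).2 (lt_irrefl _)
  have h_entry := Fin.lt_def.1 (a.strictMono (Fin.lt_def.2 (Nat.lt_succ_self (a.count t)) :
    (⟨a.count t, by omega⟩ : Fin a.len) < ⟨a.count t + 1, h_len⟩))
  omega

theorem le_iff_count : a ≤ b ↔ ∀ t, b.count t ≤ a.count t := by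
  rw [le_def]
  refine ⟨fun ⟨h_len, h_entry⟩ t => ?_, fun h => ⟨?_, fun r ha hb => ?_⟩⟩
  · refine le_of_forall_lt fun r hr => ?_
    obtain ⟨hb, hr⟩ := (b.lt_count_iff_exists r t).1 hr
    exact (a.lt_count_iff_exists r t).2
      ⟨hb.trans_le h_len, (Fin.le_def.1 (h_entry r (hb.trans_le h_len) hb)).trans_lt hr⟩
  · simpa only [count_of_le _ le_rfl] using h n
  · have h_lt := (b.lt_count_iff ⟨r, hb⟩ _).2 (Nat.lt_succ_self _)
    exact Nat.lt_succ_iff.1 ((a.lt_count_iff ⟨r, ha⟩ _).1 (h_lt.trans_le (h _)))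

theorem count_inf (a b : PluckerIndex n) (t : ℕ) :
    (a ⊓ b).count t = max (a.count t) (b.count t) := by
  refine eq_of_forall_lt_iff fun r => ?_
  simp only [lt_max_iff, lt_count_iff_exists]
  change (∃ h : r < max a.len b.len, ((PluckerIndex.inf a b).entry ⟨r, h⟩).1 < t) ↔ _
  simp only [PluckerIndex.inf]
  have := a.lt_count_iff_exists r t
  grind

theorem count_sup (a b : PluckerIndex n) (t : ℕ) :
    (a ⊔ b).count t = min (a.count t) (b.count t) := by
  refine eq_of_forall_lt_iff fun r => ?_
  simp only [lt_min_iff, lt_count_iff_exists]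
  change (∃ h : r < min a.len b.len, ((PluckerIndex.sup a b).entry ⟨r, h⟩).1 < t) ↔ _
  simp only [PluckerIndex.sup, Fin.castLE_mk, Fin.coe_max]
  grind

theorem ext_count (h : ∀ t ≤ n, a.count t = b.count t) : a = b := by
  have h_all (t : ℕ) : a.count t = b.count t := by
    rcases le_total t n with ht | ht
    · exact h t ht
    · rw [count_of_le _ ht, count_of_le _ ht, ← count_of_le a le_rfl, h n le_rfl,
        count_of_le b le_rfl]
  exact le_antisymm (le_iff_count.2 fun t => (h_all t).ge) (le_iff_count.2 fun t => (h_all t).le)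

instance : Finite (PluckerIndex n) :=
  Finite.of_injective
    (fun (a : PluckerIndex n) (t : Fin (n + 1)) =>
      (⟨a.count t, Nat.lt_succ_of_le ((a.count_le_len t).trans a.len_lt.le)⟩ : Fin (n + 1)))
    fun _ _ h => ext_count fun t ht => congrArg Fin.val (congrFun h ⟨t, Nat.lt_succ_of_le ht⟩)

/-- The `r`-th subscript is the place from which the path steps from height `r` to `r + 1`. -/
theorem exists_of_path {h : ℕ → ℕ} (h0 : h 0 = 0)
    (h_step : ∀ t < n, h (t + 1) = h t ∨ h (t + 1) = h t + 1) (h_pos : 0 < h n) (h_lt : h n < n) :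
    ∃ a : PluckerIndex n, ∀ t ≤ n, a.count t = h t := by
  have h_mono {s t : ℕ} (hst : s ≤ t) (ht : t ≤ n) : h s ≤ h t := by
    induction t, hst using Nat.le_induction with
    | base => exact le_rfl
    | succ t _ ih => exact (ih (by omega)).trans (by have := h_step t ht; omega)
  let g (r : ℕ) : ℕ := Nat.findGreatest (fun t => h t ≤ r) n
  have hg_le (r : ℕ) : h (g r) ≤ r :=
    Nat.findGreatest_spec (P := fun t => h t ≤ r) n.zero_le (h0.trans_le r.zero_le)
  have hg_lt {r t : ℕ} (ht : t ≤ n) : g r < t ↔ r < h t := by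
    rw [← not_le, ← not_le, not_iff_not]
    exact ⟨fun h' => (h_mono h' (Nat.findGreatest_le n)).trans (hg_le r),
      fun h' => Nat.le_findGreatest (P := fun t => h t ≤ r) ht h'⟩
  have hg_step {r : ℕ} (hr : r < h n) : h (g r) = r := by
    have h_top := (hg_lt le_rfl).2 hr
    have h_succ := (hg_lt (t := g r + 1) h_top).1 (Nat.lt_add_one (g r))
    have := h_step _ h_top
    have := hg_le r
    omega
  let a : PluckerIndex n :=
    { len := h n, len_pos := h_pos, len_lt := h_lt
      entry := fun r => ⟨g r, (hg_lt le_rfl).2 r.2⟩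
      strictMono := fun r s hrs => Fin.lt_def.2 <|
        (hg_lt (Nat.findGreatest_le n)).2 ((Fin.lt_def.1 hrs).trans_eq (hg_step s.2).symm) }
  refine ⟨a, fun t ht => eq_of_forall_lt_iff fun r => ?_⟩
  rw [lt_count_iff_exists]
  exact ⟨fun ⟨_, hr⟩ => (hg_lt ht).1 hr,
    fun hr => ⟨hr.trans_le (h_mono ht le_rfl), (hg_lt ht).2 hr⟩⟩

end PluckerIndex

section Permutations

/-- If `π s' < π s` with `s < s'`, interchanging the two values of `π` decreases the sum. -/
theorem eq_one_of_forall_sum_le {k : ℕ} {F : Fin k → Fin k → ℝ}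
    (hF : ∀ r r' s s', r < r' → s < s' → F r s + F r' s' < F r s' + F r' s)
    {π : Equiv.Perm (Fin k)} (h_min : ∀ π' : Equiv.Perm (Fin k), ∑ s, F (π s) s ≤ ∑ s, F (π' s) s) :
    π = 1 := by
  suffices h_mono : StrictMono π from DFunLike.coe_injective <|
    (h_mono.range_inj strictMono_id).1 (by rw [π.surjective.range_eq, Set.range_id])
  intro s s' hs
  by_contra! h_le
  have h_lt : π s' < π s := h_le.lt_of_ne (π.injective.ne hs.ne')
  have h_swap : ∑ x, (F (π x) x - F (π (Equiv.swap s s' x)) x) =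
      (F (π s) s - F (π s') s) + (F (π s') s' - F (π s) s') := by
    rw [Fintype.sum_eq_add s s' hs.ne fun x hx => by
      rw [Equiv.swap_apply_of_ne_of_ne hx.1 hx.2, sub_self], Equiv.swap_apply_left,
      Equiv.swap_apply_right]
  have h_le := h_min (π * Equiv.swap s s')
  have h_gt := hF _ _ _ _ h_lt hs
  rw [Finset.sum_sub_distrib] at h_swap
  simp only [Equiv.Perm.mul_apply] at h_le
  linarith

theorem sum_lt_sum_perm {k : ℕ} {F : Fin k → Fin k → ℝ}
    (hF : ∀ r r' s s', r < r' → s < s' → F r s + F r' s' < F r s' + F r' s)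
    {π : Equiv.Perm (Fin k)} (hπ : π ≠ 1) : ∑ s, F s s < ∑ s, F (π s) s := by
  obtain ⟨π₀, h_min⟩ := Finite.exists_min fun π : Equiv.Perm (Fin k) => ∑ s, F (π s) s
  obtain rfl := eq_one_of_forall_sum_le hF h_min
  exact (h_min π).lt_of_not_ge fun h => hπ (eq_one_of_forall_sum_le hF fun π' => h.trans (h_min π'))

end Permutations

section HomogeneousSubstitution

open MvPolynomial
open Finsupp (weight)

variable {σ τ M : Type*} [AddCommMonoid M]

theorem aeval_weightedHomogeneousComponent {e : τ → M} {deg : σ → M} {g : σ → MvPolynomial τ ℂ}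
    (hg : ∀ a, IsWeightedHomogeneous e (g a) (deg a)) (d : M) (p : MvPolynomial σ ℂ) :
    aeval g (weightedHomogeneousComponent deg d p) =
      weightedHomogeneousComponent e d (aeval g p) := by
  classical
  induction p using MvPolynomial.induction_on' with
  | monomial m c =>
    have hm : IsWeightedHomogeneous e (aeval g (monomial m c)) (weight deg m) := by
      rw [aeval_monomial, algebraMap_eq, Finsupp.weight_apply]
      exact (IsWeightedHomogeneous.prod _ _ _ fun a _ => (hg a).pow _).C_mul c
    rw [weightedHomogeneousComponent_of_mem (isWeightedHomogeneous_monomial deg m c rfl),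
      weightedHomogeneousComponent_of_mem hm, apply_ite (aeval g), map_zero]
  | add p q hp hq => simp only [map_add, hp, hq]

theorem aeval_monomial_one (e : σ → τ →₀ ℕ) (m : σ →₀ ℕ) (c : ℂ) :
    aeval (fun a => monomial (e a) (1 : ℂ)) (monomial m c) = monomial (weight e m) c := by
  simp only [aeval_monomial, algebraMap_eq, Finsupp.prod, monomial_pow, one_pow,
    ← monomial_sum_one, C_mul_monomial, mul_one, Finsupp.weight_apply, Finsupp.sum]

theorem eq_zero_of_aeval_monomial_eq_zero {e : σ → τ →₀ ℕ} {p : MvPolynomial σ ℂ}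
    (hp : aeval (fun a => monomial (e a) (1 : ℂ)) p = 0)
    (h_inj : Set.InjOn (weight e) {m | m ∈ p.support}) : p = 0 := by
  classical
  refine MvPolynomial.ext _ _ fun m => ?_
  rw [coeff_zero]
  by_contra hm
  have hm_mem := mem_support_iff.2 hm
  have h_coeff :
      ∑ m' ∈ p.support, coeff (weight e m) (monomial (weight e m') (coeff m' p)) = 0 := by
    rw [← coeff_sum, ← Finset.sum_congr rfl fun m' _ => aeval_monomial_one e m' (coeff m' p),
      ← map_sum, ← p.as_sum, hp, coeff_zero]
  rw [Finset.sum_eq_single_of_mem m hm_mem fun m' hm' h_ne => by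
    rw [coeff_monomial, if_neg fun h => h_ne (h_inj hm' hm_mem h)], coeff_monomial,
    if_pos rfl] at h_coeff
  exact hm h_coeff

end HomogeneousSubstitution

namespace PluckerIndex

open MvPolynomial
open Finsupp (weight)

variable {n : ℕ} {a b c d : PluckerIndex n}

/-- The minor formed by the rows `1, …, k` and the columns `i₁, …, i_k`, where `a` is the tuple
of subscripts `i₁ < … < i_k`. -/
def minor (a : PluckerIndex n) : MvPolynomial (Fin n × Fin n) ℂ :=
  Matrix.det (Matrix.of fun r s : Fin a.len => X (Fin.castLE a.len_lt.le r, a.entry s))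

theorem mem_pluckerIdeal {p : MvPolynomial (PluckerIndex n) ℂ} :
    p ∈ pluckerIdeal n ↔ aeval minor p = 0 := Iff.rfl

/-- The exponent of the term of `minor a` which belongs to the permutation `π`. -/
def permExp (a : PluckerIndex n) (π : Equiv.Perm (Fin a.len)) : Fin n × Fin n →₀ ℕ :=
  ∑ s, Finsupp.single (Fin.castLE a.len_lt.le (π s), a.entry s) 1

/-- The exponent of the diagonal term of `minor a`. -/
def diagExp (a : PluckerIndex n) : Fin n × Fin n →₀ ℕ :=
  permExp a 1

theorem minor_eq_sum (a : PluckerIndex n) : minor a = ∑ π : Equiv.Perm (Fin a.len),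
    monomial (permExp a π) ((Equiv.Perm.sign π : ℤ) : ℂ) := by
  rw [minor, Matrix.det_apply]
  refine Finset.sum_congr rfl fun π _ => ?_
  have h_prod : ∏ s, (X (Fin.castLE a.len_lt.le (π s), a.entry s) :
      MvPolynomial (Fin n × Fin n) ℂ) = monomial (permExp a π) 1 := (monomial_sum_one _ _).symm
  simp only [Matrix.of_apply]
  rw [h_prod, Units.smul_def, ← Int.cast_smul_eq_zsmul ℂ, smul_monomial, smul_eq_mul, mul_one]

theorem weight_permExp {M : Type*} [AddCommMonoid M] (f : Fin n × Fin n → M)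
    (a : PluckerIndex n) (π : Equiv.Perm (Fin a.len)) :
    weight f (permExp a π) = ∑ s, f (Fin.castLE a.len_lt.le (π s), a.entry s) := by
  simp [permExp, map_sum, Finsupp.weight_single]

/-- The indicator function of the upper left `k × t` corner of a matrix. -/
def corner (n k t : ℕ) (x : Fin n × Fin n) : ℕ :=
  if x.1.1 < k ∧ x.2.1 < t then 1 else 0

theorem weight_corner_diagExp (k t : ℕ) (a : PluckerIndex n) :
    weight (corner n k t) (diagExp a) = min k (a.count t) := by
  have h_count := a.count_le_len t
  rw [diagExp, weight_permExp]
  simp only [corner, Equiv.Perm.one_apply, Fin.val_castLE, ← lt_count_iff, ← lt_min_iff,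
    Finset.sum_boole, Fin.card_filter_val_lt, Nat.cast_id]
  omega

theorem weight_corner_add (E : Fin n × Fin n →₀ ℕ) (r i : Fin n) :
    weight (corner n (r + 1) (i + 1)) E + weight (corner n r i) E =
      weight (corner n (r + 1) i) E + weight (corner n r (i + 1)) E + E (r, i) := by
  classical
  have h_single : E (r, i) = weight (Pi.single (r, i) 1 : Fin n × Fin n → ℕ) E := by
    simp [Finsupp.weight_apply, Finsupp.sum_fintype, Pi.single_apply]
  simp only [h_single, Finsupp.weight_apply, Finsupp.sum, ← Finset.sum_add_distrib, ← smul_add]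
  refine Finset.sum_congr rfl fun ⟨r', i'⟩ _ => congrArg _ ?_
  simp only [corner, Pi.single_apply, Prod.mk.injEq, Fin.ext_iff]
  grind

theorem ext_of_weight_corner {E E' : Fin n × Fin n →₀ ℕ}
    (h : ∀ k t, weight (corner n k t) E = weight (corner n k t) E') : E = E' := by
  ext ⟨r, i⟩
  have hE := weight_corner_add E r i
  have hE' := weight_corner_add E' r i
  simp only [h] at hE
  omega

theorem diagExp_inf_add_sup (a b : PluckerIndex n) :
    diagExp (a ⊓ b) + diagExp (a ⊔ b) = diagExp a + diagExp b :=
  ext_of_weight_corner fun k t => by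
    simp only [map_add, weight_corner_diagExp, count_inf, count_sup]
    omega

theorem eq_of_diagExp_add_eq (hab : a ≤ b) (hcd : c ≤ d)
    (h : diagExp a + diagExp b = diagExp c + diagExp d) : a = c ∧ b = d := by
  have h_count (t : ℕ) : a.count t = c.count t ∧ b.count t = d.count t := by
    have h_corner (k : ℕ) : min k (a.count t) + min k (b.count t) =
        min k (c.count t) + min k (d.count t) := by
      simpa only [map_add, weight_corner_diagExp] using congrArg (weight (corner n k t)) h
    have h_ab := le_iff_count.1 hab t
    have h_cd := le_iff_count.1 hcd t
    have := h_corner (a.count t)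
    have := h_corner (c.count t)
    omega
  exact ⟨ext_count fun t _ => (h_count t).1, ext_count fun t _ => (h_count t).2⟩

/-- The degree of a matrix entry in a grading for which minors are homogeneous. It records the
row and the column, each through the indicator functions of initial segments. -/
def entryDegree (n : ℕ) (x : Fin n × Fin n) : (ℕ → ℕ) × (ℕ → ℕ) :=
  (fun k => if x.1.1 < k then 1 else 0, fun t => if x.2.1 < t then 1 else 0)

/-- The degree of `minor a` with respect to `entryDegree`. -/
def bidegree (a : PluckerIndex n) : (ℕ → ℕ) × (ℕ → ℕ) :=
  (min a.len, a.count)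

theorem weight_entryDegree_permExp (a : PluckerIndex n) (π : Equiv.Perm (Fin a.len)) :
    weight (entryDegree n) (permExp a π) = bidegree a := by
  rw [weight_permExp]
  refine Prod.ext ?_ ?_
  · rw [Prod.fst_sum]
    ext k
    simp only [entryDegree, bidegree, Finset.sum_apply, Fin.val_castLE]
    rw [Equiv.sum_comp π fun s => if s.1 < k then 1 else 0, Finset.sum_boole,
      Fin.card_filter_val_lt, Nat.cast_id]
  · rw [Prod.snd_sum]
    ext t
    simp only [entryDegree, bidegree, count, Finset.sum_apply, Finset.sum_boole, Nat.cast_id]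

theorem isWeightedHomogeneous_minor (a : PluckerIndex n) :
    IsWeightedHomogeneous (entryDegree n) (minor a) (bidegree a) := by
  rw [minor_eq_sum]
  exact IsWeightedHomogeneous.sum _ _ _ fun π _ =>
    isWeightedHomogeneous_monomial _ _ _ (weight_entryDegree_permExp a π)

theorem weightedHomogeneousComponent_mem_pluckerIdeal {p : MvPolynomial (PluckerIndex n) ℂ}
    (hp : p ∈ pluckerIdeal n) (δ : (ℕ → ℕ) × (ℕ → ℕ)) :
    weightedHomogeneousComponent bidegree δ p ∈ pluckerIdeal n := by
  rw [mem_pluckerIdeal, aeval_weightedHomogeneousComponent isWeightedHomogeneous_minor,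
    mem_pluckerIdeal.1 hp, map_zero]

theorem count_add_count_of_bidegree (h : bidegree a + bidegree b = bidegree c + bidegree d)
    (t : ℕ) : a.count t + b.count t = c.count t + d.count t :=
  congrFun (congrArg Prod.snd h) t

theorem len_eq_max_of_bidegree (hcd : c ≤ d)
    (h : bidegree a + bidegree b = bidegree c + bidegree d) : c.len = max a.len b.len := by
  have h_min (k : ℕ) : min a.len k + min b.len k = min c.len k + min d.len k :=
    congrFun (congrArg Prod.fst h) k
  have h_len := hcd.1
  have := h_min (max a.len b.len)
  have := h_min (max c.len d.len)
  have := h_min (min a.len b.len)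
  omega

theorem weight_bidegree_fst_one (m : PluckerIndex n →₀ ℕ) : (weight bidegree m).1 1 = m.degree := by
  rw [Finsupp.weight_apply, Finsupp.sum, Prod.fst_sum, Finset.sum_apply, Finsupp.degree_apply]
  refine Finset.sum_congr rfl fun a _ => ?_
  have h_one : min a.len 1 = 1 := Nat.min_eq_right a.len_pos
  simp only [bidegree, Prod.smul_fst, Pi.smul_apply, h_one, smul_eq_mul, mul_one]

theorem finite_weight_bidegree_eq (δ : (ℕ → ℕ) × (ℕ → ℕ)) :
    {m : PluckerIndex n →₀ ℕ | weight bidegree m = δ}.Finite :=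
  (Finsupp.finite_of_degree_le (δ.1 1)).subset fun m hm =>
    (weight_bidegree_fst_one m).symm.le.trans (congrFun (congrArg Prod.fst hm) 1).le

end PluckerIndex

section Pairs

open MvPolynomial
open Finsupp (weight)

variable {L : Type*}

/-- The exponent of the product of two variables. -/
def pairExp (a b : L) : L →₀ ℕ :=
  Finsupp.single a 1 + Finsupp.single b 1

theorem pairExp_comm (a b : L) : pairExp a b = pairExp b a :=
  add_comm _ _

theorem weight_pairExp {M : Type*} [AddCommMonoid M] (w : L → M) (a b : L) :
    weight w (pairExp a b) = w a + w b := by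
  simp [pairExp, Finsupp.weight_single]

theorem monomial_pairExp (a b : L) : monomial (pairExp a b) (1 : ℂ) = X a * X b := by
  simp [pairExp, X, monomial_mul]

/-- The exponents of the products of two incomparable variables, which generate
`nonstandardIdeal L`. -/
def incomparablePairs (L : Type*) [LE L] : Set (L →₀ ℕ) :=
  {m | ∃ a b : L, ¬ a ≤ b ∧ ¬ b ≤ a ∧ pairExp a b = m}

theorem nonstandardIdeal_eq_monomialIdeal [Lattice L] :
    nonstandardIdeal L = monomialIdeal (incomparablePairs L) := by
  refine congrArg Ideal.span (Set.ext fun q => ⟨?_, ?_⟩)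
  · rintro ⟨a, b, hab, hba, rfl⟩
    exact ⟨_, ⟨a, b, hab, hba, rfl⟩, monomial_pairExp a b⟩
  · rintro ⟨_, ⟨a, b, hab, hba, rfl⟩, rfl⟩
    exact ⟨a, b, hab, hba, monomial_pairExp a b⟩

theorem hibiIdeal_eq_span_incomparable [Lattice L] : hibiIdeal L =
    Ideal.span {q | ∃ a b : L, ¬ a ≤ b ∧ ¬ b ≤ a ∧ q = X a * X b - X (a ⊔ b) * X (a ⊓ b)} := by
  refine le_antisymm (Ideal.span_le.2 ?_) (Ideal.span_mono ?_)
  · rintro _ ⟨a, b, rfl⟩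
    by_cases hab : a ≤ b
    · rw [sup_eq_right.2 hab, inf_eq_left.2 hab, mul_comm, sub_self]
      exact Ideal.zero_mem _
    · by_cases hba : b ≤ a
      · rw [sup_eq_left.2 hba, inf_eq_right.2 hba, sub_self]
        exact Ideal.zero_mem _
      · exact Ideal.subset_span ⟨a, b, hab, hba, rfl⟩
  · rintro _ ⟨a, b, -, -, rfl⟩
    exact ⟨a, b, rfl⟩

theorem incomparablePairs_not_le {m : L →₀ ℕ} [LE L]
    (hm : ∀ a ∈ m.support, ∀ b ∈ m.support, a ≤ b ∨ b ≤ a) :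
    ∀ p ∈ incomparablePairs L, ¬ p ≤ m := by
  rintro _ ⟨a, b, hab, hba, rfl⟩ h_le
  have h_mem {x : L} (hx : pairExp a b x ≠ 0) : x ∈ m.support :=
    Finsupp.support_mono h_le (Finsupp.mem_support_iff.2 hx)
  exact (hm a (h_mem (by simp [pairExp])) b (h_mem (by simp [pairExp]))).elim hab hba

theorem exists_pairExp_of_degree_eq_two [LE L] {m : L →₀ ℕ} (h_deg : m.degree = 2)
    (hm : ∀ p ∈ incomparablePairs L, ¬ p ≤ m) : ∃ c d : L, c ≤ d ∧ m = pairExp c d := by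
  classical
  obtain ⟨c, d, h_eq⟩ := Multiset.card_eq_two.1 ((Finsupp.card_toMultiset m).trans h_deg)
  have hm_eq : m = pairExp c d := by
    rw [← Finsupp.toMultiset_toFinsupp m, h_eq, Multiset.insert_eq_cons,
      ← Multiset.singleton_add, map_add, Multiset.toFinsupp_singleton,
      Multiset.toFinsupp_singleton, pairExp]
  by_cases hcd : c ≤ d
  · exact ⟨c, d, hcd, hm_eq⟩
  · by_cases hdc : d ≤ c
    · exact ⟨d, c, hdc, hm_eq.trans (pairExp_comm c d)⟩
    · exact absurd hm_eq.ge (hm _ ⟨c, d, hcd, hdc, rfl⟩)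

end Pairs

namespace PluckerIndex

open MvPolynomial
open Finsupp (weight)

variable {n : ℕ}

section DiagonalTerms

/-- A weight of matrix entries for which the diagonal terms of all minors are the lightest. -/
def DiagonalWeight (f : Fin n × Fin n → ℝ) : Prop :=
  ∀ r r' i i' : Fin n, r < r' → i < i' → f (r, i) + f (r', i') < f (r, i') + f (r', i)

variable {f : Fin n × Fin n → ℝ}

theorem DiagonalWeight.weight_diagExp_lt (hf : DiagonalWeight f) (a : PluckerIndex n)
    {π : Equiv.Perm (Fin a.len)} (hπ : π ≠ 1) :
    weight f (diagExp a) < weight f (permExp a π) := by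
  rw [diagExp, weight_permExp, weight_permExp]
  exact sum_lt_sum_perm (F := fun r s => f (Fin.castLE a.len_lt.le r, a.entry s))
    (fun r r' s s' hr hs => hf _ _ _ _ hr (a.strictMono hs)) hπ

theorem DiagonalWeight.minor_mem_weightFiltration (hf : DiagonalWeight f) (a : PluckerIndex n) :
    minor a ∈ weightFiltration f (weight f (diagExp a)) := by
  rw [minor_eq_sum]
  refine Submodule.sum_mem _ fun π _ => ?_
  refine weightFiltration_antitone f ?_ (monomial_mem_weightFiltration f (permExp a π) _)
  obtain rfl | hπ := eq_or_ne π 1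
  · exact le_rfl
  · exact (hf.weight_diagExp_lt a hπ).le

theorem DiagonalWeight.weightedHomogeneousComponent_minor (hf : DiagonalWeight f)
    (a : PluckerIndex n) : weightedHomogeneousComponent f (weight f (diagExp a)) (minor a) =
      monomial (diagExp a) 1 := by
  rw [minor_eq_sum, map_sum, Finset.sum_eq_single_of_mem 1 (Finset.mem_univ _) fun π _ hπ =>
    weightedHomogeneousComponent_of_lt (hf.weight_diagExp_lt a hπ)
      (monomial_mem_weightFiltration f (permExp a π) _)]
  rw [Equiv.Perm.sign_one, Units.val_one, Int.cast_one]
  exact weightedHomogeneousComponent_monomial_same f (diagExp a) 1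

/-- The ideal of relations between the diagonal terms of the minors. -/
def diagIdeal (n : ℕ) : Ideal (MvPolynomial (PluckerIndex n) ℂ) :=
  RingHom.ker (aeval fun a : PluckerIndex n => monomial (diagExp a) (1 : ℂ) :
    MvPolynomial (PluckerIndex n) ℂ →ₐ[ℂ] MvPolynomial (Fin n × Fin n) ℂ)

theorem mem_diagIdeal {p : MvPolynomial (PluckerIndex n) ℂ} : p ∈ diagIdeal n ↔
    aeval (fun a : PluckerIndex n => monomial (diagExp a) (1 : ℂ)) p = 0 := Iff.rfl

theorem hibiIdeal_le_diagIdeal : hibiIdeal (PluckerIndex n) ≤ diagIdeal n := by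
  refine Ideal.span_le.2 ?_
  rintro _ ⟨a, b, rfl⟩
  rw [SetLike.mem_coe, mem_diagIdeal, map_sub, map_mul, map_mul]
  simp only [aeval_X, monomial_mul, mul_one]
  rw [add_comm (diagExp (a ⊔ b)), diagExp_inf_add_sup, sub_self]

theorem DiagonalWeight.initialPart_mem_diagIdeal (hf : DiagonalWeight f)
    {p : MvPolynomial (PluckerIndex n) ℂ} (hp : p ∈ pluckerIdeal n) :
    initialPart (fun a => weight f (diagExp a)) p ∈ diagIdeal n := by
  obtain ⟨μ, hμ, h_initial⟩ := exists_initialPart_eq (fun a => weight f (diagExp a)) p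
  rw [h_initial, mem_diagIdeal, ← funext hf.weightedHomogeneousComponent_minor,
    ← weightedHomogeneousComponent_aeval hf.minor_mem_weightFiltration hμ, mem_pluckerIdeal.1 hp,
    map_zero]

theorem eq_zero_of_mem_diagIdeal {p : MvPolynomial (PluckerIndex n) ℂ}
    (hp : ∀ q ∈ p.support, ∃ c d, c ≤ d ∧ q = pairExp c d) (h : p ∈ diagIdeal n) : p = 0 := by
  refine eq_zero_of_aeval_monomial_eq_zero (mem_diagIdeal.1 h) fun m hm m' hm' h_eq => ?_
  obtain ⟨c, d, hcd, rfl⟩ := hp m hm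
  obtain ⟨c', d', hcd', rfl⟩ := hp m' hm'
  rw [weight_pairExp, weight_pairExp] at h_eq
  obtain ⟨rfl, rfl⟩ := eq_of_diagExp_add_eq hcd hcd' h_eq
  rfl

theorem eq_monomial_of_sub_mem_diagIdeal {a b : PluckerIndex n}
    {p : MvPolynomial (PluckerIndex n) ℂ} (hp : ∀ q ∈ p.support, ∃ c d, c ≤ d ∧ q = pairExp c d)
    (h : monomial (pairExp a b) 1 - p ∈ diagIdeal n) :
    p = monomial (pairExp (a ⊓ b) (a ⊔ b)) 1 := by
  classical
  refine sub_eq_zero.1 (eq_zero_of_mem_diagIdeal (fun m hm => ?_) ?_)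
  · obtain hm | hm := Finset.mem_union.1 (support_sub _ _ _ hm)
    · exact hp m hm
    · exact ⟨a ⊓ b, a ⊔ b, inf_le_sup, Finset.mem_singleton.1 (support_monomial_subset hm)⟩
  · rw [mem_diagIdeal, map_sub, aeval_monomial_one, weight_pairExp, sub_eq_zero] at h
    rw [mem_diagIdeal, map_sub, aeval_monomial_one, weight_pairExp, diagExp_inf_add_sup, ← h,
      sub_self]

end DiagonalTerms

section PathWeights

/-- The weight which is the sum, over the points `(t, m)` with `0 < t ≤ n` of the path of `a`, of
the values `G (t - 1) m`. -/
def pathWeight (G : ℕ → ℕ → ℝ) (a : PluckerIndex n) : ℝ :=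
  ∑ t ∈ Finset.range n, G t (a.count (t + 1))

theorem pathWeight_inf_add_sup (G : ℕ → ℕ → ℝ) (a b : PluckerIndex n) :
    pathWeight G (a ⊓ b) + pathWeight G (a ⊔ b) = pathWeight G a + pathWeight G b := by
  simp only [pathWeight, ← Finset.sum_add_distrib, count_inf, count_sup]
  refine Finset.sum_congr rfl fun t _ => ?_
  obtain h | h := le_total (a.count (t + 1)) (b.count (t + 1))
  · rw [max_eq_right h, min_eq_left h, add_comm]
  · rw [max_eq_left h, min_eq_right h]

/-- Strict convexity of every sequence `G t`. -/
def StrictlyConvex (G : ℕ → ℕ → ℝ) : Prop :=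
  ∀ t m, 2 * G t (m + 1) < G t m + G t (m + 2)

variable {G : ℕ → ℕ → ℝ}

/-- The weights of matrix entries which induce the path weight given by `G`: the entry in row `r`
and column `i` is charged for the step of a path from height `r` to `r + 1` at place `i`, which
changes the heights of all later points. -/
def entryWeight (n : ℕ) (G : ℕ → ℕ → ℝ) (x : Fin n × Fin n) : ℝ :=
  ∑ t ∈ Finset.range n, if x.2.1 ≤ t then G t (x.1 + 1) - G t x.1 else 0

theorem StrictlyConvex.diagonalWeight (hG : StrictlyConvex G) :
    DiagonalWeight (entryWeight n G) := by
  intro r r' i i' hr hi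
  have h_slope (t : ℕ) : G t (r + 1) - G t r < G t (r' + 1) - G t r' :=
    strictMono_nat_of_lt_succ (f := fun m => G t (m + 1) - G t m)
      (fun m => by linarith [hG t m]) (Fin.lt_def.1 hr)
  have h_lt : entryWeight n G (r', i') - entryWeight n G (r, i') <
      entryWeight n G (r', i) - entryWeight n G (r, i) := by
    simp only [entryWeight, ← Finset.sum_sub_distrib]
    refine Finset.sum_lt_sum (fun t _ => ?_) ⟨i, Finset.mem_range.2 i.2, ?_⟩
    · have := h_slope t
      have := Fin.lt_def.1 hi
      split_ifs <;> first | omega | linarith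
    · rw [if_neg (Fin.lt_def.1 hi).not_ge, if_neg (Fin.lt_def.1 hi).not_ge, if_pos le_rfl,
        if_pos le_rfl]
      linarith [h_slope i]
  linarith

theorem weight_entryWeight_diagExp (h0 : ∀ t, G t 0 = 0) (a : PluckerIndex n) :
    weight (entryWeight n G) (diagExp a) = pathWeight G a := by
  rw [diagExp, weight_permExp]
  simp only [entryWeight, pathWeight]
  rw [Finset.sum_comm]
  refine Finset.sum_congr rfl fun t _ => ?_
  have h_entry (r : Fin a.len) : (a.entry r).1 ≤ t ↔ r.1 < a.count (t + 1) := by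
    rw [lt_count_iff, Nat.lt_succ_iff]
  have h_filter : {r ∈ Finset.range a.len | r < a.count (t + 1)} =
      Finset.range (a.count (t + 1)) := by
    have := a.count_le_len (t + 1)
    ext r
    simp only [Finset.mem_filter, Finset.mem_range]
    omega
  simp only [Equiv.Perm.one_apply, h_entry, Fin.val_castLE]
  rw [Fin.sum_univ_eq_sum_range
    (fun r => if r < a.count (t + 1) then G t (r + 1) - G t r else 0) a.len,
    ← Finset.sum_filter, h_filter, Finset.sum_range_sub (G t), h0, sub_zero]

theorem StrictlyConvex.initialPart_mem_diagIdeal (hG : StrictlyConvex G) (h0 : ∀ t, G t 0 = 0)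
    {p : MvPolynomial (PluckerIndex n) ℂ} (hp : p ∈ pluckerIdeal n) :
    initialPart (pathWeight G) p ∈ diagIdeal n := by
  rw [← funext (weight_entryWeight_diagExp h0)]
  exact hG.diagonalWeight.initialPart_mem_diagIdeal hp

end PathWeights

end PluckerIndex

namespace PluckerIndex

open MvPolynomial
open Finsupp (weight)

section Straightening

variable {n : ℕ} {a b : PluckerIndex n} {w w₀ : PluckerIndex n → ℝ} {q : PluckerIndex n →₀ ℕ}
  (hc : IsCompl ((pluckerIdeal n).restrictScalars ℂ)
    (standardSpan (incomparablePairs (PluckerIndex n))))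

theorem pairExp_mem_incomparablePairs (hab : ¬ a ≤ b) (hba : ¬ b ≤ a) :
    pairExp a b ∈ incomparablePairs (PluckerIndex n) :=
  ⟨a, b, hab, hba, rfl⟩

theorem exists_pairExp_of_mem_support_normalForm
    (hq : q ∈ (normalForm hc (monomial (pairExp a b) 1)).support) :
    ∃ c d, c ≤ d ∧ q = pairExp c d ∧ bidegree a + bidegree b = bidegree c + bidegree d := by
  have h_deg := weight_eq_of_mem_support_normalForm hc
    (fun _ hp δ => weightedHomogeneousComponent_mem_pluckerIdeal hp δ) hq
  have h_two : q.degree = 2 := by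
    rw [← weight_bidegree_fst_one, h_deg, weight_bidegree_fst_one, pairExp, map_add,
      Finsupp.degree_single, Finsupp.degree_single]
  obtain ⟨c, d, hcd, rfl⟩ := exists_pairExp_of_degree_eq_two h_two
    (mem_standardSpan.1 (normalForm_mem_standardSpan hc _) q hq)
  exact ⟨c, d, hcd, rfl, by rw [← weight_pairExp, ← weight_pairExp, h_deg]⟩

theorem normalForm_initial_of_initialPart_mem_diagIdeal (hab : ¬ a ≤ b) (hba : ¬ b ≤ a)
    (h : initialPart w (straightening hc (pairExp a b)) ∈ diagIdeal n) :
    normalForm hc (monomial (pairExp a b) 1) ∈ weightFiltration w (weight w (pairExp a b)) ∧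
      weightedHomogeneousComponent w (weight w (pairExp a b))
        (normalForm hc (monomial (pairExp a b) 1)) = monomial (pairExp (a ⊓ b) (a ⊔ b)) 1 := by
  set N := normalForm hc (monomial (pairExp a b) 1) with hN
  have h_self := coeff_straightening_self hc (pairExp_mem_incomparablePairs hab hba)
  obtain ⟨μ, hμ, h0⟩ := exists_weightedHomogeneousComponent_ne_zero w
    (ne_zero_iff.2 ⟨_, h_self.trans_ne one_ne_zero⟩)
  have h_pairs : ∀ q ∈ (weightedHomogeneousComponent w μ N).support,
      ∃ c d : PluckerIndex n, c ≤ d ∧ q = pairExp c d := fun q hq => by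
    classical
    rw [mem_support_iff, coeff_weightedHomogeneousComponent, ite_ne_right_iff,
      ← mem_support_iff] at hq
    obtain ⟨c, d, hcd, hq', -⟩ := exists_pairExp_of_mem_support_normalForm hc hq.2
    exact ⟨c, d, hcd, hq'⟩
  rw [initialPart_eq_weightedHomogeneousComponent hμ h0] at h
  obtain rfl : weight w (pairExp a b) = μ := by
    by_contra h_ne
    rw [straightening, map_sub, (isWeightedHomogeneous_monomial w
      (pairExp a b) (1 : ℂ) rfl).weightedHomogeneousComponent_ne μ (Ne.symm h_ne), zero_sub] at h h0
    exact h0 (by rw [eq_zero_of_mem_diagIdeal h_pairs ((neg_mem_iff).1 h), neg_zero])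
  refine ⟨?_, eq_monomial_of_sub_mem_diagIdeal h_pairs ?_⟩
  · rw [hN, ← sub_sub_cancel (monomial (pairExp a b) 1) (normalForm hc _)]
    exact Submodule.sub_mem _ (monomial_mem_weightFiltration w _ 1) hμ
  · rwa [straightening, map_sub, weightedHomogeneousComponent_monomial_same] at h

/-- Convexity of every sequence `G t`. -/
def WeaklyConvex (G : ℕ → ℕ → ℝ) : Prop :=
  ∀ t m, 2 * G t (m + 1) ≤ G t m + G t (m + 2)

theorem strictlyConvex_sq : StrictlyConvex fun _ m => (m : ℝ) ^ 2 := by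
  intro t m
  push_cast
  linarith

theorem coeff_hibi_normalForm (hab : ¬ a ≤ b) (hba : ¬ b ≤ a) :
    coeff (pairExp (a ⊓ b) (a ⊔ b)) (normalForm hc (monomial (pairExp a b) 1)) = 1 :=
  ((weightedHomogeneousComponent_eq_monomial_iff one_ne_zero).1
    (normalForm_initial_of_initialPart_mem_diagIdeal hc hab hba
      (strictlyConvex_sq.initialPart_mem_diagIdeal (by simp) (straightening_mem hc _))).2).1

theorem lt_weight_of_initialPart_mem_diagIdeal (hab : ¬ a ≤ b) (hba : ¬ b ≤ a)
    (h : initialPart w (straightening hc (pairExp a b)) ∈ diagIdeal n)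
    (hq : q ∈ (normalForm hc (monomial (pairExp a b) 1)).support)
    (h_ne : q ≠ pairExp (a ⊓ b) (a ⊔ b)) : weight w (pairExp a b) < weight w q := by
  obtain ⟨h_fil, h_comp⟩ := normalForm_initial_of_initialPart_mem_diagIdeal hc hab hba h
  exact (mem_weightFiltration.1 h_fil q hq).lt_of_ne'
    (((weightedHomogeneousComponent_eq_monomial_iff one_ne_zero).1 h_comp).2.2 q hq h_ne)

theorem mem_groebnerCone_hibiIdeal_iff
    (hw₀ : w₀ ∈ groebnerCone (pluckerIdeal n) (nonstandardIdeal (PluckerIndex n))) :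
    w ∈ groebnerCone (pluckerIdeal n) (hibiIdeal (PluckerIndex n)) ↔
      ∀ a b, ¬ a ≤ b → ¬ b ≤ a → w a + w b = w (a ⊓ b) + w (a ⊔ b) ∧
        ∀ q ∈ (normalForm hc (monomial (pairExp a b) 1)).support,
          q ≠ pairExp (a ⊓ b) (a ⊔ b) → weight w (pairExp a b) < weight w q := by
  constructor
  · intro hw a b hab hba
    have h := hibiIdeal_le_diagIdeal
      (initialPart_mem_of_mem_groebnerCone hw (straightening_mem hc (pairExp a b)))
    refine ⟨?_, fun q => lt_weight_of_initialPart_mem_diagIdeal hc hab hba h⟩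
    rw [← weight_pairExp, ← weight_pairExp]
    exact ((weightedHomogeneousComponent_eq_monomial_iff one_ne_zero).1
      (normalForm_initial_of_initialPart_mem_diagIdeal hc hab hba h).2).2.1.symm
  · intro hw
    have h_fil : ∀ m ∈ incomparablePairs (PluckerIndex n),
        normalForm hc (monomial m 1) ∈ weightFiltration w (weight w m) := by
      rintro _ ⟨a, b, hab, hba, rfl⟩
      refine mem_weightFiltration.2 fun q hq => ?_
      obtain rfl | h_ne := eq_or_ne q (pairExp (a ⊓ b) (a ⊔ b))
      · rw [weight_pairExp, weight_pairExp, (hw a b hab hba).1]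
      · exact ((hw a b hab hba).2 q hq h_ne).le
    have h_initial (a b : PluckerIndex n) (hab : ¬ a ≤ b) (hba : ¬ b ≤ a) :
        initialPart w (straightening hc (pairExp a b)) = X a * X b - X (a ⊔ b) * X (a ⊓ b) := by
      rw [initialPart_straightening hc (pairExp_mem_incomparablePairs hab hba)
        (h_fil _ (pairExp_mem_incomparablePairs hab hba)),
        (weightedHomogeneousComponent_eq_monomial_iff one_ne_zero).2
          ⟨coeff_hibi_normalForm hc hab hba, ?_,
            fun q hq h_ne => ((hw a b hab hba).2 q hq h_ne).ne'⟩,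
        monomial_pairExp, monomial_pairExp, mul_comm (X (a ⊓ b))]
      rw [weight_pairExp, weight_pairExp, (hw a b hab hba).1]
    rw [nonstandardIdeal_eq_monomialIdeal] at hw₀
    rw [mem_groebnerCone, initialSpan_eq_span_initialPart_straightening finite_weight_bidegree_eq
      (fun _ hp δ => weightedHomogeneousComponent_mem_pluckerIdeal hp δ) hc hw₀ h_fil]
    rw [hibiIdeal_eq_span_incomparable]
    refine congrArg (fun s => (Ideal.span s).restrictScalars ℂ) (Set.ext fun p => ⟨?_, ?_⟩)
    · rintro ⟨_, ⟨a, b, hab, hba, rfl⟩, rfl⟩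
      exact ⟨a, b, hab, hba, h_initial a b hab hba⟩
    · rintro ⟨a, b, hab, hba, rfl⟩
      exact ⟨_, ⟨a, b, hab, hba, rfl⟩, h_initial a b hab hba⟩

theorem weight_le_of_weaklyConvex {G : ℕ → ℕ → ℝ} (hG : WeaklyConvex G) (h0 : ∀ t, G t 0 = 0)
    (hab : ¬ a ≤ b) (hba : ¬ b ≤ a)
    (hq : q ∈ (normalForm hc (monomial (pairExp a b) 1)).support) :
    weight (pathWeight G) (pairExp a b) ≤ weight (pathWeight G) q := by
  obtain ⟨c, d, -, rfl, -⟩ := exists_pairExp_of_mem_support_normalForm hc hq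
  simp only [weight_pairExp]
  obtain h_eq | h_ne := eq_or_ne (pairExp c d) (pairExp (a ⊓ b) (a ⊔ b))
  · rw [← weight_pairExp _ c, h_eq, weight_pairExp, pathWeight_inf_add_sup]
  set S : PluckerIndex n → ℝ := pathWeight fun _ m => (m : ℝ) ^ 2 with hS
  have h_lt (ε : ℝ) (hε : 0 < ε) : pathWeight G a + pathWeight G b ≤
      pathWeight G c + pathWeight G d + ε * (S c + S d - S a - S b) := by
    have h_convex : StrictlyConvex fun t m => G t m + ε * (m : ℝ) ^ 2 := fun t m => by
      have := mul_lt_mul_of_pos_left (strictlyConvex_sq t m) hε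
      linarith [hG t m]
    have h_add (x : PluckerIndex n) :
        pathWeight (fun t m => G t m + ε * (m : ℝ) ^ 2) x = pathWeight G x + ε * S x := by
      simp only [hS, pathWeight, Finset.sum_add_distrib, Finset.mul_sum]
    have := lt_weight_of_initialPart_mem_diagIdeal hc hab hba
      (h_convex.initialPart_mem_diagIdeal (by simp [h0]) (straightening_mem hc _)) hq h_ne
    simp only [weight_pairExp, h_add] at this
    linarith
  refine ge_of_tendsto (f := fun ε : ℝ => pathWeight G c + pathWeight G d +
    ε * (S c + S d - S a - S b)) (x := nhdsWithin 0 (Set.Ioi 0)) ?_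
    (Filter.eventually_of_mem self_mem_nhdsWithin h_lt)
  have h_cont : Continuous fun ε : ℝ => pathWeight G c + pathWeight G d +
    ε * (S c + S d - S a - S b) := by fun_prop
  simpa only [zero_mul, add_zero] using (h_cont.tendsto 0).mono_left nhdsWithin_le_nhds

end Straightening

end PluckerIndex

namespace PluckerIndex

open MvPolynomial
open Finsupp (weight)

section StraighteningTerms

variable {n : ℕ} {a b c d e : PluckerIndex n} {w w₀ : PluckerIndex n → ℝ}
  {q : PluckerIndex n →₀ ℕ} (hc : IsCompl ((pluckerIdeal n).restrictScalars ℂ)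
    (standardSpan (incomparablePairs (PluckerIndex n))))

theorem pathWeight_ite {s : ℕ} (hs : s < n) (g : ℕ → ℝ) (a : PluckerIndex n) :
    pathWeight (fun t x => if t = s then g x else 0) a = g (a.count (s + 1)) := by
  rw [pathWeight, Finset.sum_ite_eq', if_pos (Finset.mem_range.2 hs)]

section

variable (hab : ¬ a ≤ b) (hba : ¬ b ≤ a) (hcd : c ≤ d)
  (hq : pairExp c d ∈ (normalForm hc (monomial (pairExp a b) 1)).support)

include hab hba hcd hq

/-- If `c` violated the bound at the point `t`, then the convex function of the height at `t` which
vanishes up to `max (a.count t) (b.count t) - 1` would be smaller on `c`, `d` than on `a`, `b`. -/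
theorem max_count_le {t : ℕ} (ht : t ≤ n) : max (a.count t) (b.count t) ≤ c.count t := by
  obtain _ | s := t
  · simp only [count_zero, max_self, le_refl]
  by_contra! h_lt
  set M := max (a.count (s + 1)) (b.count (s + 1))
  set G : ℕ → ℕ → ℝ := fun t x => if t = s then ((x - (M - 1) : ℕ) : ℝ) else 0 with hG
  have h_convex : WeaklyConvex G := fun t x => by
    have h : 2 * (x + 1 - (M - 1)) ≤ (x - (M - 1)) + (x + 2 - (M - 1)) := by omega
    simp only [hG]
    split_ifs
    · exact_mod_cast h
    · simp
  have h_weight := weight_le_of_weaklyConvex hc h_convex (fun t => by simp [hG]) hab hba hq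
  simp only [weight_pairExp, hG, pathWeight_ite ht] at h_weight
  have h_weight : a.count (s + 1) - (M - 1) + (b.count (s + 1) - (M - 1)) ≤
      c.count (s + 1) - (M - 1) + (d.count (s + 1) - (M - 1)) := by exact_mod_cast h_weight
  have h_le := le_iff_count.1 hcd (s + 1)
  omega

theorem le_inf_of_mem_support_normalForm : c ≤ a ⊓ b := by
  refine le_iff_count.2 fun t => ?_
  rw [count_inf]
  obtain ht | ht := le_total t n
  · exact max_count_le hc hab hba hcd hq ht
  · have h := max_count_le hc hab hba hcd hq le_rfl
    simpa only [count_of_le _ ht, count_of_le _ le_rfl] using h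

end

theorem exists_le_inf_sup_le_of_mem_support_normalForm (hab : ¬ a ≤ b) (hba : ¬ b ≤ a)
    (hq : q ∈ (normalForm hc (monomial (pairExp a b) 1)).support) :
    ∃ c d, q = pairExp c d ∧ c ≤ a ⊓ b ∧ a ⊔ b ≤ d ∧
      bidegree a + bidegree b = bidegree c + bidegree d := by
  obtain ⟨c, d, hcd, rfl, h_deg⟩ := exists_pairExp_of_mem_support_normalForm hc hq
  have h_inf := le_inf_of_mem_support_normalForm hc hab hba hcd hq
  refine ⟨c, d, rfl, h_inf, le_iff_count.2 fun t => ?_, h_deg⟩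
  have h_count := le_iff_count.1 h_inf t
  have h_sum := count_add_count_of_bidegree h_deg t
  rw [count_inf] at h_count
  rw [count_sup]
  omega

theorem apply_eq_zero_of_mem_support_normalForm (hab : ¬ a ≤ b) (hba : ¬ b ≤ a)
    (hq : q ∈ (normalForm hc (monomial (pairExp a b) 1)).support) : q a = 0 ∧ q b = 0 := by
  obtain ⟨c, d, rfl, h_inf, h_sup, -⟩ :=
    exists_le_inf_sup_le_of_mem_support_normalForm hc hab hba hq
  obtain ⟨hca, hcb⟩ := le_inf_iff.1 h_inf
  obtain ⟨had, hbd⟩ := sup_le_iff.1 h_sup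
  have h_ne : c ≠ a ∧ c ≠ b ∧ d ≠ a ∧ d ≠ b :=
    ⟨fun h => hab (h ▸ hcb), fun h => hba (h ▸ hca), fun h => hba (h ▸ hbd),
      fun h => hab (h ▸ had)⟩
  simp [pairExp, h_ne]

theorem incomparablePairs_not_le_single_add_pairExp (hce : c ≤ e) (hed : e ≤ d) :
    ∀ m ∈ incomparablePairs (PluckerIndex n), ¬ m ≤ Finsupp.single e 1 + pairExp c d := by
  have h_mem {x : PluckerIndex n} (hx : x ∈ (Finsupp.single e 1 + pairExp c d).support) :
      x = e ∨ x = c ∨ x = d := by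
    by_contra! h
    exact Finsupp.mem_support_iff.1 hx (by simp [pairExp, h])
  refine incomparablePairs_not_le fun x hx y hy => ?_
  have hcd := hce.trans hed
  obtain rfl | rfl | rfl := h_mem hx <;> obtain rfl | rfl | rfl := h_mem hy <;>
    simp only [le_refl, hce, hed, hcd, true_or, or_true]

/-- Multiply the tight straightening relation of `a`, `b` by `X e`. Its term `X c * X d * X e` is
standard, hence occurs in the normal form of `X a * X b * X e`, which can also be computed by
straightening `X a * X e` first. -/
theorem exists_weight_le_of_tight
    (hw₀ : w₀ ∈ groebnerCone (pluckerIdeal n) (monomialIdeal (incomparablePairs (PluckerIndex n))))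
    (hw : ∀ m ∈ incomparablePairs (PluckerIndex n),
      normalForm hc (monomial m 1) ∈ weightFiltration w (weight w m))
    (hq : pairExp c d ∈ (normalForm hc (monomial (pairExp a b) 1)).support)
    (hce : c ≤ e) (hed : e ≤ d) (h_tight : weight w (pairExp a b) = weight w (pairExp c d))
    (h_other : ∀ q ∈ (normalForm hc (monomial (pairExp a b) 1)).support, q ≠ pairExp c d →
      weight w (pairExp a b) < weight w q) :
    ∃ q ∈ (normalForm hc (monomial (pairExp a e) 1)).support,
      weight w q ≤ weight w (pairExp a e) := by
  by_contra! h_lt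
  have hI (p) (hp : p ∈ pluckerIdeal n) (δ) := weightedHomogeneousComponent_mem_pluckerIdeal hp δ
  have h_mem := add_mem_support_normalForm finite_weight_bidegree_eq hI hc hw₀ hw hq
    (incomparablePairs_not_le_single_add_pairExp hce hed) (h_tight ▸ h_other)
  have h_swap : Finsupp.single e 1 + pairExp a b = Finsupp.single b 1 + pairExp a e := by
    simp only [pairExp]
    abel
  have h_heavier := lt_weight_of_mem_support_normalForm_add (u := Finsupp.single b 1)
    finite_weight_bidegree_eq hI hc hw₀ hw
    (fun q hq => (add_lt_add_right (h_lt q hq) (weight w (Finsupp.single b 1))).trans_eq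
      (map_add _ _ _).symm)
  refine (h_heavier _ (h_swap ▸ h_mem)).ne ?_
  rw [← map_add, ← h_swap, map_add, map_add, h_tight]

end StraighteningTerms

end PluckerIndex

namespace PluckerIndex

open Finsupp (weight)

section FlatPathWeights

variable {n : ℕ}

theorem weight_pathWeight_sub (G : ℕ → ℕ → ℝ) (a b c d : PluckerIndex n) :
    weight (pathWeight G) (pairExp c d) - weight (pathWeight G) (pairExp a b) =
      ∑ t ∈ Finset.range n, (G t (c.count (t + 1)) + G t (d.count (t + 1)) -
        G t (a.count (t + 1)) - G t (b.count (t + 1))) := by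
  simp only [weight_pairExp, pathWeight, Finset.sum_sub_distrib, Finset.sum_add_distrib]
  ring

theorem weight_pathWeight_sub_of_single {a b c d : PluckerIndex n}
    (hsum : ∀ t ≤ n, a.count t + b.count t = c.count t + d.count t) {s m : ℕ} (hs : s < n)
    (ha : a.count (s + 1) = m) (hb : b.count (s + 1) = m) (hc : c.count (s + 1) = m + 1)
    (hmax : ∀ t ≤ n, t ≠ s + 1 → c.count t = max (a.count t) (b.count t)) (G : ℕ → ℕ → ℝ) :
    weight (pathWeight G) (pairExp c d) - weight (pathWeight G) (pairExp a b) =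
      G s (m + 1) + G s (m - 1) - 2 * G s m := by
  rw [weight_pathWeight_sub, Finset.sum_eq_single s]
  · have h_sum := hsum (s + 1) hs
    rw [ha, hb, hc, show d.count (s + 1) = m - 1 by omega]
    ring
  · intro t ht hts
    have h_sum := hsum (t + 1) (Finset.mem_range.1 ht)
    have h_max := hmax (t + 1) (Finset.mem_range.1 ht) (by omega)
    obtain h | h := le_total (a.count (t + 1)) (b.count (t + 1))
    · rw [h_max, max_eq_right h, show d.count (t + 1) = a.count (t + 1) by omega]
      ring
    · rw [h_max, max_eq_left h, show d.count (t + 1) = b.count (t + 1) by omega]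
      ring
  · exact fun h => absurd (Finset.mem_range.2 hs) h

theorem sum_range_add_sum_range_sub (f : ℕ → ℝ) (D j k : ℕ) :
    ∑ i ∈ Finset.range (D + k + j + k), f i + ∑ i ∈ Finset.range D, f i -
      ∑ i ∈ Finset.range (D + k + j), f i - ∑ i ∈ Finset.range (D + k), f i =
      ∑ i ∈ Finset.range k, (f (D + k + j + i) - f (D + i)) := by
  rw [Finset.sum_range_add f (D + k + j), Finset.sum_range_add f D k, Finset.sum_sub_distrib]
  ring

/-- The slopes `i + 1`, for `i < m`, and `i`, for `i ≥ m`, of a convex sequence which is straight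
at `m` only. -/
def flatSlope (m i : ℕ) : ℝ :=
  if i < m then i + 1 else i

theorem flatSlope_mono (m : ℕ) : Monotone (flatSlope m) :=
  monotone_nat_of_le_succ fun i => by
    unfold flatSlope
    split_ifs <;> first | omega | (push_cast; linarith)

theorem flatSlope_eq_iff {m i j : ℕ} (hij : i < j) :
    flatSlope m i = flatSlope m j ↔ j = m ∧ i + 1 = m := by
  unfold flatSlope
  split_ifs <;> norm_cast <;> omega

/-- Sequences that are strictly convex, except that the one with index `s` is straight at `m`. -/
def flatConvex (s m t x : ℕ) : ℝ :=
  ∑ i ∈ Finset.range x, flatSlope (if t = s then m else 0) i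

variable {s m t A B C D : ℕ}

theorem flatConvex_exchange_eq {j k : ℕ} :
    flatConvex s m t (D + k + j + k) + flatConvex s m t D - flatConvex s m t (D + k + j) -
      flatConvex s m t (D + k) = ∑ i ∈ Finset.range k,
        (flatSlope (if t = s then m else 0) (D + k + j + i) -
          flatSlope (if t = s then m else 0) (D + i)) :=
  sum_range_add_sum_range_sub _ D j k

theorem flatConvex_exchange (hsum : A + B = C + D) (hA : A ≤ C) (hB : B ≤ C) :
    0 ≤ flatConvex s m t C + flatConvex s m t D - flatConvex s m t A - flatConvex s m t B ∧
    (flatConvex s m t C + flatConvex s m t D - flatConvex s m t A - flatConvex s m t B = 0 →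
      C = max A B ∨ t = s ∧ A = m ∧ B = m ∧ C = m + 1) := by
  wlog hBA : B ≤ A generalizing A B
  · rw [sub_right_comm, max_comm, and_left_comm (a := A = m)]
    exact this (by omega) hB hA (by omega)
  obtain ⟨k, rfl⟩ := exists_add_of_le hA
  obtain rfl : B = D + k := by omega
  obtain ⟨j, rfl⟩ := exists_add_of_le hBA
  have h_nonneg : ∀ i ∈ Finset.range k, 0 ≤ flatSlope (if t = s then m else 0) (D + k + j + i) -
      flatSlope (if t = s then m else 0) (D + i) :=
    fun i _ => sub_nonneg.2 (flatSlope_mono _ (by omega))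
  rw [flatConvex_exchange_eq, Finset.sum_eq_zero_iff_of_nonneg h_nonneg]
  refine ⟨Finset.sum_nonneg h_nonneg, fun h_zero => ?_⟩
  have h_flat {i : ℕ} (hi : i < k) := (flatSlope_eq_iff (by omega)).1
    (sub_eq_zero.1 (h_zero i (Finset.mem_range.2 hi))).symm
  obtain rfl | h_pos := Nat.eq_zero_or_pos k
  · exact Or.inl (by omega)
  have h_first := h_flat h_pos
  have h_last := h_flat (Nat.sub_lt h_pos one_pos)
  split_ifs at h_first h_last with hts
  · exact Or.inr ⟨hts, by omega, by omega, by omega⟩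
  · omega

theorem weight_flatConvex_sub {a b c d : PluckerIndex n} {s m : ℕ}
    (hsum : ∀ t ≤ n, a.count t + b.count t = c.count t + d.count t)
    (hca : c ≤ a) (hcb : c ≤ b) :
    0 ≤ weight (pathWeight (flatConvex s m)) (pairExp c d) -
      weight (pathWeight (flatConvex s m)) (pairExp a b) ∧
    (weight (pathWeight (flatConvex s m)) (pairExp c d) -
      weight (pathWeight (flatConvex s m)) (pairExp a b) = 0 → ∀ t < n,
      c.count (t + 1) = max (a.count (t + 1)) (b.count (t + 1)) ∨
        t = s ∧ a.count (t + 1) = m ∧ b.count (t + 1) = m ∧ c.count (t + 1) = m + 1) := by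
  have h_term (t : ℕ) (ht : t < n) := flatConvex_exchange (s := s) (m := m) (t := t)
    (hsum (t + 1) ht) (le_iff_count.1 hca _) (le_iff_count.1 hcb _)
  have h_nonneg := fun t ht => (h_term t (Finset.mem_range.1 ht)).1
  rw [weight_pathWeight_sub, Finset.sum_eq_zero_iff_of_nonneg h_nonneg]
  exact ⟨Finset.sum_nonneg h_nonneg, fun h t ht => (h_term t ht).2 (h t (Finset.mem_range.2 ht))⟩

end FlatPathWeights

end PluckerIndex

section PolyhedralCones

open Filter Topology

variable {V ι : Type*} [AddCommGroup V] [Module ℝ V]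

/-- The cone cut out by the inequalities `0 ≤ ℓ i x` in the subspace `H`. -/
def polyhedralCone (H : Submodule ℝ V) (ℓ : ι → Module.Dual ℝ V) : Set V :=
  {x | x ∈ H ∧ ∀ i, 0 ≤ ℓ i x}

variable {H : Submodule ℝ V} {ℓ : ι → Module.Dual ℝ V} {w w' : V}

theorem exists_pos_forall_nonneg [Finite ι] {v : V}
    (h : ∀ i, 0 < ℓ i w ∨ ℓ i w = 0 ∧ ℓ i v = 0) :
    ∃ ε : ℝ, 0 < ε ∧ ∀ i, 0 ≤ ℓ i (w + ε • v) := by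
  have h_near (i : ι) : ∀ᶠ ε : ℝ in 𝓝[>] 0, 0 ≤ ℓ i (w + ε • v) := by
    simp only [map_add, map_smul, smul_eq_mul]
    obtain h_pos | ⟨hw, hv⟩ := h i
    · have h_lim : Tendsto (fun ε : ℝ => ℓ i w + ε * ℓ i v) (𝓝[>] 0) (𝓝 (ℓ i w + 0 * ℓ i v)) :=
        Continuous.tendsto (by fun_prop) _ |>.mono_left nhdsWithin_le_nhds
      rw [zero_mul, add_zero] at h_lim
      exact (h_lim.eventually (lt_mem_nhds h_pos)).mono fun _ => le_of_lt
    · simp [hw, hv]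
  obtain ⟨ε, h_nonneg, hε⟩ := ((eventually_all.2 h_near).and self_mem_nhdsWithin).exists
  exact ⟨ε, hε, h_nonneg⟩

theorem vectorSpan_eq_of_core {S : Set V} (hS : S ⊆ H) (hw : w ∈ S)
    (h : ∀ v ∈ H, ∃ ε : ℝ, 0 < ε ∧ w + ε • v ∈ S) : vectorSpan ℝ S = H := by
  apply le_antisymm
  · rw [vectorSpan_def, Submodule.span_le]
    rintro _ ⟨x, hx, y, hy, rfl⟩
    exact H.sub_mem (hS hx) (hS hy)
  · intro v hv
    obtain ⟨ε, hε, h_mem⟩ := h v hv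
    have h_smul := Submodule.smul_mem _ ε⁻¹ (vsub_mem_vectorSpan ℝ h_mem hw)
    rwa [vsub_eq_sub, add_sub_cancel_left, inv_smul_smul₀ hε.ne'] at h_smul

theorem vectorSpan_polyhedralCone [Finite ι] (hw : w ∈ H) (hpos : ∀ i, 0 < ℓ i w) :
    vectorSpan ℝ (polyhedralCone H ℓ) = H := by
  refine vectorSpan_eq_of_core (fun x hx => hx.1) ⟨hw, fun i => (hpos i).le⟩ fun v hv => ?_
  obtain ⟨ε, hε, h_nonneg⟩ := exists_pos_forall_nonneg fun i => Or.inl (hpos i)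
  exact ⟨ε, hε, H.add_mem hw (H.smul_mem _ hv), h_nonneg⟩

theorem exists_apply_eq_zero_of_nonpos [Finite ι] {l : Module.Dual ℝ V} (hl : l ≠ 0)
    (h_nonpos : ∀ x ∈ polyhedralCone ⊤ ℓ, l x ≤ 0) (hw : w ∈ polyhedralCone ⊤ ℓ) (h0 : l w = 0) :
    ∃ i, ℓ i w = 0 := by
  by_contra! h_ne
  have h_le (v : V) : l v ≤ 0 := by
    obtain ⟨ε, hε, h_nonneg⟩ := exists_pos_forall_nonneg (v := v) fun i =>
      Or.inl ((hw.2 i).lt_of_ne' (h_ne i))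
    have h := h_nonpos _ ⟨trivial, h_nonneg⟩
    rw [map_add, h0, zero_add, map_smul, smul_eq_mul] at h
    exact nonpos_of_mul_nonpos_right h hε
  refine hl (LinearMap.ext fun v => le_antisymm (h_le v) ?_)
  simpa using h_le (-v)

theorem exists_forall_apply_eq_zero_of_apply_eq_zero [Finite ι] {l : Module.Dual ℝ V}
    (hne : {x ∈ polyhedralCone H ℓ | l x = 0}.Nonempty) :
    ∃ w ∈ {x ∈ polyhedralCone H ℓ | l x = 0}, ∀ i, ℓ i w = 0 →
      ∀ x ∈ {x ∈ polyhedralCone H ℓ | l x = 0}, ℓ i x = 0 := by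
  have := Fintype.ofFinite ι
  obtain ⟨x₀, hx₀⟩ := hne
  have h_point (i : ι) : ∃ x ∈ {x ∈ polyhedralCone H ℓ | l x = 0}, ℓ i x = 0 →
      ∀ y ∈ {x ∈ polyhedralCone H ℓ | l x = 0}, ℓ i y = 0 := by
    by_contra! h
    obtain ⟨-, y, hy, hy0⟩ := h x₀ hx₀
    exact hy0 (h y hy).1
  choose p hp h_tight using h_point
  refine ⟨∑ i, p i, ⟨⟨H.sum_mem fun i _ => (hp i).1.1, fun i => ?_⟩, ?_⟩, fun i h_zero => ?_⟩
  · rw [map_sum]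
    exact Finset.sum_nonneg fun j _ => (hp j).1.2 i
  · rw [map_sum]
    exact Finset.sum_eq_zero fun j _ => (hp j).2
  · rw [map_sum, Finset.sum_eq_zero_iff_of_nonneg fun j _ => (hp j).1.2 i] at h_zero
    exact h_tight i (h_zero i (Finset.mem_univ i))

theorem exists_pos_smul_eq_of_ker_eq {f g : Module.Dual ℝ V}
    (h : LinearMap.ker f = LinearMap.ker g) (hf : 0 < f w) (hg : 0 < g w) :
    ∃ s : ℝ, 0 < s ∧ g = s • f := by
  refine ⟨g w / f w, div_pos hg hf, LinearMap.ext fun v => ?_⟩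
  have h_mem : v - (f v / f w) • w ∈ LinearMap.ker f := by
    rw [LinearMap.mem_ker, map_sub, map_smul, smul_eq_mul, div_mul_cancel₀ _ hf.ne', sub_self]
  rw [h, LinearMap.mem_ker, map_sub, map_smul, smul_eq_mul, sub_eq_zero] at h_mem
  rw [h_mem, LinearMap.smul_apply, smul_eq_mul]
  ring

theorem vectorSpan_eq_ker [FiniteDimensional ℝ V] {F : Set V}
    (h_dim : Module.finrank ℝ (vectorSpan ℝ F) + 1 = Module.finrank ℝ V) {g : Module.Dual ℝ V}
    (hg : g ≠ 0) (hF : ∀ y ∈ F, g y = 0) : vectorSpan ℝ F = LinearMap.ker g := by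
  refine Submodule.eq_of_le_of_finrank_eq ?_ ?_
  · rw [vectorSpan_def, Submodule.span_le]
    rintro _ ⟨x, hx, y, hy, rfl⟩
    exact LinearMap.sub_mem_ker_iff.2 ((hF x hx).trans (hF y hy).symm)
  · have h_ker := Module.Dual.finrank_ker_add_one_of_ne_zero hg
    omega

theorem finrank_inf_ker_add_one [FiniteDimensional ℝ V] {l : Module.Dual ℝ V} (hw : w ∈ H)
    (hl : l w ≠ 0) :
    Module.finrank ℝ (H ⊓ LinearMap.ker l : Submodule ℝ V) + 1 = Module.finrank ℝ H := by
  have h_ne : l.comp H.subtype ≠ 0 := fun h => hl (LinearMap.congr_fun h ⟨w, hw⟩)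
  rw [← Module.Dual.finrank_ker_add_one_of_ne_zero h_ne, LinearMap.ker_comp,
    ← Submodule.map_comap_subtype, Submodule.finrank_map_subtype_eq]

variable [TopologicalSpace V]

theorem exists_eq_of_isExposed_polyhedralCone {F : Set V} (hne : F.Nonempty)
    (hF : IsExposed ℝ (polyhedralCone H ℓ) F) :
    ∃ l : Module.Dual ℝ V, (∀ x ∈ polyhedralCone H ℓ, l x ≤ 0) ∧
      F = {x ∈ polyhedralCone H ℓ | l x = 0} := by
  obtain ⟨l, hl⟩ := hF hne
  obtain ⟨x₀, hx₀⟩ := hl ▸ hne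
  have h_zero_mem : (0 : V) ∈ polyhedralCone H ℓ := ⟨H.zero_mem, fun i => (map_zero (ℓ i)).ge⟩
  have h_max : l x₀ = 0 := by
    have h_zero := hx₀.2 0 h_zero_mem
    have h_two := hx₀.2 ((2 : ℝ) • x₀) ⟨H.smul_mem _ hx₀.1.1, fun i => by
      rw [map_smul]
      exact smul_nonneg two_pos.le (hx₀.1.2 i)⟩
    rw [map_zero] at h_zero
    rw [map_smul, smul_eq_mul] at h_two
    linarith
  have h_nonpos (x : V) (hx : x ∈ polyhedralCone H ℓ) : l x ≤ 0 := h_max ▸ hx₀.2 x hx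
  refine ⟨l, h_nonpos, hl.trans (Set.ext fun x => and_congr_right fun hx =>
    ⟨fun h => ?_, fun h y hy => (h_nonpos y hy).trans_eq h.symm⟩)⟩
  exact le_antisymm (h_nonpos x hx) ((map_zero l).ge.trans (h 0 h_zero_mem))

variable [FiniteDimensional ℝ V]

theorem closure_strict_cone [IsTopologicalAddGroup V] [ContinuousSMul ℝ V] [T2Space V]
    (hw : w ∈ H) (hpos : ∀ i, 0 < ℓ i w) :
    closure {x | x ∈ H ∧ ∀ i, 0 < ℓ i x} = polyhedralCone H ℓ := by
  apply Set.Subset.antisymm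
  · refine closure_minimal (fun x hx => ⟨hx.1, fun i => (hx.2 i).le⟩) ?_
    suffices h : IsClosed {x : V | ∀ i, 0 ≤ ℓ i x} from H.closed_of_finiteDimensional.inter h
    rw [Set.ofPred_forall]
    exact isClosed_iInter fun i => isClosed_le continuous_const
      (LinearMap.continuous_of_finiteDimensional (ℓ i))
  · rintro x ⟨hx, h_nonneg⟩
    have h_lim : Tendsto (fun ε : ℝ => x + ε • w) (𝓝[>] 0) (𝓝 (x + (0 : ℝ) • w)) :=
      Continuous.tendsto (by fun_prop) _ |>.mono_left nhdsWithin_le_nhds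
    rw [zero_smul, add_zero] at h_lim
    refine mem_closure_of_tendsto h_lim ?_
    filter_upwards [self_mem_nhdsWithin] with ε hε
    refine ⟨H.add_mem hx (H.smul_mem _ hw), fun i => ?_⟩
    rw [map_add, map_smul]
    exact add_pos_of_nonneg_of_pos (h_nonneg i) (smul_pos hε (hpos i))

variable [Finite ι]

theorem IsFacet.exists_inequality (hpos : ∀ i, 0 < ℓ i w) {F : Set V}
    (hF : IsFacet F (polyhedralCone ⊤ ℓ)) :
    ∃ i₀, F = {x ∈ polyhedralCone ⊤ ℓ | ℓ i₀ x = 0} ∧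
      ∃ w' ∈ F, ∀ j, ℓ j w' = 0 → ∃ s : ℝ, 0 < s ∧ ℓ j = s • ℓ i₀ := by
  obtain ⟨hne, h_exp, h_dim⟩ := hF
  have h_span := vectorSpan_polyhedralCone (H := ⊤) trivial hpos
  obtain ⟨l, h_nonpos, rfl⟩ := exists_eq_of_isExposed_polyhedralCone hne h_exp
  rw [h_span, finrank_top] at h_dim
  have hl : l ≠ 0 := by
    rintro rfl
    have h_face : {x ∈ polyhedralCone ⊤ ℓ | (0 : Module.Dual ℝ V) x = 0} = polyhedralCone ⊤ ℓ :=
      Set.ext fun x => and_iff_left rfl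
    rw [h_face, h_span, finrank_top] at h_dim
    omega
  obtain ⟨w', hw', h_tight⟩ := exists_forall_apply_eq_zero_of_apply_eq_zero hne
  have h_ne_zero (i : ι) : ℓ i ≠ 0 := fun h => (hpos i).ne' (LinearMap.congr_fun h w)
  have h_ker (j : ι) (hj : ℓ j w' = 0) : LinearMap.ker (ℓ j) = LinearMap.ker l :=
    (vectorSpan_eq_ker h_dim (h_ne_zero j) (h_tight j hj)).symm.trans
      (vectorSpan_eq_ker h_dim hl fun _ hy => hy.2)
  obtain ⟨i₀, hi₀⟩ := exists_apply_eq_zero_of_nonpos hl h_nonpos hw'.1 hw'.2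
  refine ⟨i₀, Set.ext fun x => and_congr_right fun _ => ?_, w', hw', fun j hj =>
    exists_pos_smul_eq_of_ker_eq ((h_ker i₀ hi₀).trans (h_ker j hj).symm) (hpos i₀) (hpos j)⟩
  exact (SetLike.ext_iff.1 (h_ker i₀ hi₀) x).symm

variable [IsTopologicalAddGroup V] [ContinuousSMul ℝ V] [T2Space V]

/-- A linear inequality cuts out a facet if some point of the cone satisfies with equality only
those inequalities which are implied by it. -/
theorem isFacet_of_tight (hw : w ∈ H) (hpos : ∀ i, 0 < ℓ i w) {i₀ : ι} (hw' : w' ∈ H)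
    (h0 : ℓ i₀ w' = 0) (h_tight : ∀ i, 0 < ℓ i w' ∨ ∀ v ∈ H, ℓ i₀ v = 0 → ℓ i v = 0) :
    IsFacet {x ∈ polyhedralCone H ℓ | ℓ i₀ x = 0} (polyhedralCone H ℓ) := by
  have h_mem : w' ∈ polyhedralCone H ℓ :=
    ⟨hw', fun i => (h_tight i).elim le_of_lt fun h => (h w' hw' h0).ge⟩
  refine ⟨⟨w', h_mem, h0⟩, fun _ => ⟨LinearMap.toContinuousLinearMap (-ℓ i₀), ?_⟩, ?_⟩
  · refine Set.ext fun x => and_congr_right fun hx => ?_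
    simp only [LinearMap.coe_toContinuousLinearMap', LinearMap.neg_apply, neg_le_neg_iff]
    exact ⟨fun hx0 y hy => hx0.trans_le (hy.2 i₀),
      fun h => le_antisymm ((h w' h_mem).trans_eq h0) (hx.2 i₀)⟩
  · have h_span : vectorSpan ℝ {x ∈ polyhedralCone H ℓ | ℓ i₀ x = 0} =
        H ⊓ LinearMap.ker (ℓ i₀) := by
      refine vectorSpan_eq_of_core (fun x hx => ⟨hx.1.1, hx.2⟩) ⟨h_mem, h0⟩ ?_
      rintro v ⟨hv, hv0⟩
      obtain ⟨ε, hε, h_nonneg⟩ := exists_pos_forall_nonneg fun i =>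
        (h_tight i).imp id fun h => ⟨h w' hw' h0, h v hv hv0⟩
      exact ⟨ε, hε, ⟨H.add_mem hw' (H.smul_mem _ hv), h_nonneg⟩,
        (LinearMap.ker (ℓ i₀)).add_mem h0 (Submodule.smul_mem _ _ hv0)⟩
    rw [h_span, vectorSpan_polyhedralCone hw hpos, finrank_inf_ker_add_one hw (hpos i₀).ne']

end PolyhedralCones

section WeightFunctional

variable {σ : Type*}

/-- The weight of a fixed monomial, as a linear functional of the weights of the variables. -/
def weightFunctional (m : σ →₀ ℕ) : Module.Dual ℝ (σ → ℝ) :=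
  ∑ a ∈ m.support, (m a : ℝ) • LinearMap.proj a

theorem weightFunctional_apply (m : σ →₀ ℕ) (w : σ → ℝ) :
    weightFunctional m w = Finsupp.weight w m := by
  simp [weightFunctional, Finsupp.weight_apply, Finsupp.sum]

end WeightFunctional

namespace PluckerIndex

section Raises

variable {n : ℕ} {a b c e m : PluckerIndex n} {p q t y : ℕ}

/-- `e` arises from `a` by raising the path of `a` by one at the single place `t`. -/
def IsRaise (a e : PluckerIndex n) (t : ℕ) : Prop :=
  t ≤ n ∧ ∀ s ≤ n, e.count s = a.count s + if s = t then 1 else 0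

theorem le_iff_count_of_le : a ≤ b ↔ ∀ t ≤ n, b.count t ≤ a.count t := by
  refine le_iff_count.trans ⟨fun h t _ => h t, fun h t => ?_⟩
  obtain ht | ht := le_total t n
  · exact h t ht
  · simpa only [count_of_le _ le_rfl, count_of_le _ ht] using h n le_rfl

namespace IsRaise

theorem count_self (h : IsRaise a e t) : e.count t = a.count t + 1 := by
  rw [h.2 t h.1, if_pos rfl]

theorem count_of_ne (h : IsRaise a e t) {s : ℕ} (hs : s ≤ n) (hst : s ≠ t) :
    e.count s = a.count s := by
  rw [h.2 s hs, if_neg hst, add_zero]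

theorem pos (h : IsRaise a e t) : 0 < t :=
  Nat.pos_of_ne_zero fun ht => by simpa [ht] using h.count_self

theorem le_of_lt (h : IsRaise a e t) (hca : c ≤ a) (ht : a.count t < c.count t) : c ≤ e := by
  rw [le_iff_count_of_le] at hca ⊢
  intro s hs
  rw [h.2 s hs]
  split_ifs with hst
  · exact hst ▸ ht
  · exact hca s hs

theorem covBy (h : IsRaise a e t) : e ⋖ a := by
  refine ⟨lt_of_le_not_ge (le_iff_count_of_le.2 fun s hs => ?_) fun h_le => ?_, fun x hex hxa => ?_⟩
  · rw [h.2 s hs]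
    exact Nat.le_add_right _ _
  · exact absurd (le_iff_count.1 h_le t) (by rw [h.count_self]; omega)
  · have h_other (s : ℕ) (hs : s ≤ n) (hst : s ≠ t) : x.count s = a.count s :=
      le_antisymm (h.count_of_ne hs hst ▸ le_iff_count.1 hex.le s) (le_iff_count.1 hxa.le s)
    have h_upper := le_iff_count.1 hex.le t
    rw [h.count_self] at h_upper
    obtain h_eq | h_lt := (le_iff_count.1 hxa.le t).eq_or_lt
    · refine hxa.ne (ext_count fun s hs => ?_)
      obtain rfl | hst := eq_or_ne s t
      exacts [h_eq.symm, h_other s hs hst]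
    · refine hex.ne (ext_count fun s hs => ?_)
      obtain rfl | hst := eq_or_ne s t
      · rw [h.count_self]
        omega
      · rw [h_other s hs hst, h.count_of_ne hs hst]

theorem place_unique (hp : IsRaise a e p) (hq : IsRaise a e q) : p = q := by
  by_contra h
  have h_self := hp.count_self
  have h_ne := hq.count_of_ne hp.1 h
  omega

end IsRaise

theorem exists_isRaise (h0 : 0 < t) (ht : t ≤ n) (h_flat : a.count t = a.count (t - 1))
    (h_up : t < n → a.count (t + 1) = a.count t + 1) (h_end : t = n → a.count n + 1 < n) :
    ∃ e, IsRaise a e t := by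
  have h_len := a.count_of_le le_rfl
  have h_pos := a.len_pos
  have h_lt := a.len_lt
  set h : ℕ → ℕ := fun s => a.count s + if s = t then 1 else 0 with hh
  have h_step (s : ℕ) (hs : s < n) : h (s + 1) = h s ∨ h (s + 1) = h s + 1 := by
    have h_step := a.count_succ s
    obtain rfl | hst := eq_or_ne s t
    · simpa [hh] using Or.inl (h_up hs)
    obtain rfl | hst' := eq_or_ne (s + 1) t
    · exact Or.inr (by simpa [hh, hst] using h_flat)
    · simpa [hh, hst, hst'] using h_step
  obtain ⟨e, he⟩ := exists_of_path (by simp [hh, h0.ne]) h_step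
    (by simp only [hh]; omega)
    (by simp only [hh]; split_ifs with h; exacts [h_end h.symm, by omega])
  exact ⟨e, ht, he⟩

theorem exists_isRaise_left (hy : y < n) (h_gap : a.count y < c.count y)
    (h_up : a.count (y + 1) = a.count y + 1) :
    ∃ t ≤ y, a.count t < c.count t ∧ ∃ e, IsRaise a e t := by
  induction y with
  | zero => simp at h_gap
  | succ y ih =>
    obtain h | h := a.count_succ y
    · exact ⟨y + 1, le_rfl, h_gap, exists_isRaise (by omega) hy.le h (fun _ => h_up) (by omega)⟩
    · have h_step := c.count_succ y
      obtain ⟨t, ht, h_raise⟩ := ih (by omega) (by omega) h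
      exact ⟨t, by omega, h_raise⟩

theorem exists_isRaise_right (hy : y < n) (h_gap : a.count (y + 1) < c.count (y + 1))
    (h_flat : a.count (y + 1) = a.count y) :
    ∃ t > y, t ≤ n ∧ a.count t < c.count t ∧ ∃ e, IsRaise a e t := by
  have h_le := Nat.le_sub_one_of_lt hy
  induction h_le using Nat.decreasingInduction with
  | self =>
    have h_len := c.count_le_len n
    have h_lt := c.len_lt
    rw [Nat.sub_add_cancel (by omega)] at h_gap h_flat
    exact ⟨n, by omega, le_rfl, h_gap, exists_isRaise (by omega) le_rfl h_flat (by omega)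
      (fun _ => by omega)⟩
  | of_succ y hy' ih =>
    obtain h | h := a.count_succ (y + 1)
    · have h_mono := c.count_mono (Nat.le_add_right (y + 1) 1)
      obtain ⟨t, ht, h_raise⟩ := ih (by omega) (by omega) h
      exact ⟨t, by omega, h_raise⟩
    · exact ⟨y + 1, by omega, hy, h_gap, exists_isRaise (by omega) hy h_flat (fun _ => h)
        (by omega)⟩

theorem exists_isRaise_le_of_lt (hca : c < a) :
    ∃ t e, IsRaise a e t ∧ a.count t < c.count t ∧ c ≤ e := by
  obtain ⟨y, hy, h_gap⟩ : ∃ y ≤ n, a.count y < c.count y := by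
    by_contra! h
    exact hca.not_ge (le_iff_count_of_le.2 h)
  obtain _ | y := y
  · simp at h_gap
  obtain h | h := a.count_succ y
  · obtain ⟨t, -, -, h_lt, e, he⟩ := exists_isRaise_right hy h_gap h
    exact ⟨t, e, he, h_lt, he.le_of_lt hca.le h_lt⟩
  · have h_step := c.count_succ y
    obtain ⟨t, -, h_lt, e, he⟩ := exists_isRaise_left (c := c) hy (by omega) h
    exact ⟨t, e, he, h_lt, he.le_of_lt hca.le h_lt⟩

/-- Wherever the path of `a` runs strictly below that of `c`, it is flat before the place `p` and
ascends after it. -/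
def IsValley (a c : PluckerIndex n) (p : ℕ) : Prop :=
  ∀ t < n, a.count t < c.count t ∨ a.count (t + 1) < c.count (t + 1) →
    (a.count (t + 1) = a.count t ↔ t < p)

theorem isValley_of_forall_isRaise
    (h : ∀ t e, IsRaise a e t → a.count t < c.count t → t = p) : IsValley a c p := by
  intro t ht h_gap
  have h_step := c.count_succ t
  obtain h_flat | h_up := a.count_succ t
  · obtain ⟨u, htu, -, h_lt, e, he⟩ := exists_isRaise_right (c := c) ht (by omega) h_flat
    exact iff_of_true h_flat (h u e he h_lt ▸ htu)
  · obtain ⟨u, hut, h_lt, e, he⟩ := exists_isRaise_left (c := c) ht (by omega) h_up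
    exact iff_of_false (by omega) (h u e he h_lt ▸ hut.not_gt)

namespace IsValley

theorem count_eq_of_le (h : IsValley a c p) (h_gap : a.count y < c.count y) (hyt : y ≤ t)
    (htp : t ≤ p) (ht : t ≤ n) : a.count t = a.count y := by
  induction t, hyt using Nat.le_induction with
  | base => rfl
  | succ t hyt ih =>
    have h_eq := ih (by omega) (by omega)
    have h_mono := c.count_mono hyt
    exact ((h t ht (Or.inl (by omega))).2 htp).trans h_eq

theorem lt_of_le (h : IsValley a c p) (h_gap : a.count y < c.count y) (hpt : p ≤ t) (hty : t ≤ y)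
    (hy : y ≤ n) : a.count t < c.count t := by
  induction hty using Nat.decreasingInduction with
  | self => exact h_gap
  | of_succ t hty ih =>
    have h_lt := ih (by omega)
    have h_step := c.count_succ t
    have h_up := (a.count_succ t).resolve_left fun h_flat =>
      hpt.not_gt ((h t (by omega) (Or.inr h_lt)).1 h_flat)
    omega

end IsValley

theorem exists_isRaise_inf_isValley (hab : ¬ a ≤ b) (hca : c ≤ a) (hcb : c ≤ b)
    (h : ∀ e, c ≤ e → e < a → e ≤ b) : ∃ p, IsRaise a (a ⊓ b) p ∧ IsValley a c p := by
  have h_inf : a ⊓ b < a := inf_lt_left.2 hab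
  have h_eq {t : ℕ} {e : PluckerIndex n} (he : IsRaise a e t) (h_lt : a.count t < c.count t) :
      a ⊓ b = e :=
    have hea := he.covBy.lt
    ((he.covBy.eq_or_eq (le_inf hea.le (h e (he.le_of_lt hca h_lt) hea)) inf_le_left).resolve_right
      h_inf.ne)
  obtain ⟨p, e, he, h_lt, -⟩ := exists_isRaise_le_of_lt ((le_inf hca hcb).trans_lt h_inf)
  have hp : IsRaise a (a ⊓ b) p := h_eq he h_lt ▸ he
  exact ⟨p, hp, isValley_of_forall_isRaise fun t e' he' h_lt' =>
    (h_eq he' h_lt' ▸ he').place_unique hp⟩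

section Rigidity

variable (hap : IsRaise a m p) (hbq : IsRaise b m q) (ha : IsValley a c p)
  (hb : IsValley b c q) (hpq : p < q)

include hap hbq ha hb hpq

theorem place_lt_of_gap (hy : y ≤ n) (h_gap : m.count y < c.count y) : p < y := by
  by_contra! hyp
  have h_pos := hap.pos
  have hpn := hap.1
  have h_by := hbq.count_of_ne hy (hyp.trans_lt hpq).ne
  have h_run := hb.count_eq_of_le (h_by ▸ h_gap) hyp hpq.le hpn
  have h_mono := c.count_mono hyp
  have h_ap := hap.count_self
  have h_bp := hbq.count_of_ne hpn hpq.ne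
  obtain ⟨r, rfl⟩ := Nat.exists_eq_add_one.2 h_pos
  have h_flat_a := (ha r hpn (Or.inr (by omega))).2 (by omega)
  have h_flat_b := (hb r hpn (Or.inr (by omega))).2 (by omega)
  have h_ar := hap.count_of_ne (s := r) (by omega) (by omega)
  have h_br := hbq.count_of_ne (s := r) (by omega) (by omega)
  omega

theorem count_le_of_isValley (hcm : c ≤ m) (hcn : c.count n = m.count n) (hqt : q ≤ t)
    (ht : t ≤ n) : c.count t ≤ a.count t := by
  by_contra! h_gap
  have h_gap_q := ha.lt_of_le h_gap hpq.le hqt ht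
  have h_aq := hap.count_of_ne hbq.1 hpq.ne'
  have h_bq := hbq.count_self
  have h_q := le_iff_count.1 hcm q
  obtain rfl | hqn := hbq.1.eq_or_lt
  · omega
  have h_step_a := ha q hqn (Or.inl h_gap_q)
  have h_step_b := hb q hqn (Or.inl (by omega))
  have h_succ_a := a.count_succ q
  have h_succ_b := b.count_succ q
  have h_as := hap.count_of_ne (s := q + 1) hqn (by omega)
  have h_bs := hbq.count_of_ne (s := q + 1) hqn (by omega)
  omega

theorem isValley_rigid (hcm : c ≤ m) (hcn : c.count n = m.count n) (hy : y ≤ n)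
    (h_gap : m.count y < c.count y) :
    y = p + 1 ∧ q = p + 2 ∧ c.count y = m.count y + 1 := by
  have hpy := place_lt_of_gap hap hbq ha hb hpq hy h_gap
  have hqn := hbq.1
  have h_end {t : ℕ} (hqt : q ≤ t) (ht : t ≤ n) :=
    count_le_of_isValley hap hbq ha hb hpq hcm hcn hqt ht
  have h_a {t : ℕ} (ht : t ≤ n) (htp : t ≠ p) := hap.count_of_ne ht htp
  have h_b {t : ℕ} (ht : t ≤ n) (htq : t ≠ q) := hbq.count_of_ne ht htq
  have h_ay := h_a hy hpy.ne'
  have hyq : y < q := by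
    by_contra! hqy
    exact absurd (h_end hqy hy) (by omega)
  have h_by := h_b hy hyq.ne
  obtain ⟨r, rfl⟩ := Nat.exists_eq_add_one.2 (Nat.zero_lt_of_lt hpy)
  have h_up_into := ha r hy (Or.inr (by omega))
  have h_flat_into := hb r hy (Or.inr (by omega))
  have h_up_out := ha (r + 1) (by omega) (Or.inl (by omega))
  have h_flat_out := hb (r + 1) (by omega) (Or.inl (by omega))
  have h_first : r = p := by
    by_contra h_ne
    have h_ar := h_a (t := r) (by omega) h_ne
    have h_br := h_b (t := r) (by omega) (by omega)
    omega
  have h_last : q = r + 1 + 1 := by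
    by_contra h_ne
    have h_as := h_a (t := r + 1 + 1) (by omega) (by omega)
    have h_bs := h_b (t := r + 1 + 1) (by omega) (by omega)
    omega
  have h_mono := c.count_mono hyq.le
  have h_top := h_end le_rfl hbq.1
  have h_succ := a.count_succ (r + 1)
  subst h_last
  omega

end Rigidity

theorem isRaise_of_isValley (hne : p ≠ q) (hap : IsRaise a m p) (hbq : IsRaise b m q)
    (ha : IsValley a c p) (hb : IsValley b c q) (hcm : c < m) (hcn : c.count n = m.count n) :
    ∃ y, IsRaise m c y ∧ a.count y = b.count y := by
  wlog hpq : p < q generalizing a b p q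
  · obtain ⟨y, hy, h_eq⟩ := this hne.symm hbq hap hb ha (hne.symm.lt_of_le (not_lt.1 hpq))
    exact ⟨y, hy, h_eq.symm⟩
  have h_rigid {y : ℕ} := isValley_rigid (y := y) hap hbq ha hb hpq hcm.le hcn
  obtain ⟨y, hy, h_gap⟩ : ∃ y ≤ n, m.count y < c.count y := by
    by_contra! h
    exact hcm.not_ge (le_iff_count_of_le.2 h)
  obtain ⟨hyp, hqp, h_y⟩ := h_rigid hy h_gap
  refine ⟨y, ⟨hy, fun s hs => ?_⟩, ?_⟩
  · split_ifs with hsy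
    · exact hsy ▸ h_y
    · refine le_antisymm (not_lt.1 fun h_lt => hsy ?_) (le_iff_count.1 hcm.le s)
      exact (h_rigid hs h_lt).1.trans hyp.symm
  · rw [← hap.count_of_ne hy (by omega), hbq.count_of_ne hy (by omega)]

theorem interval_rigid (hab : ¬ a ≤ b) (hba : ¬ b ≤ a) (hca : c ≤ a) (hcb : c ≤ b)
    (hcn : c.count n = (a ⊓ b).count n)
    (h : ∀ e, c ≤ e → e ≤ a ⊔ b → e ≠ a → e ≠ b → (a ≤ e ∨ e ≤ a) ∧ (b ≤ e ∨ e ≤ b))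
    (hc : c ≠ a ⊓ b) :
    ∃ y, IsRaise (a ⊓ b) c y ∧ a.count y = b.count y := by
  obtain ⟨p, hp, hp_valley⟩ := exists_isRaise_inf_isValley hab hca hcb fun e hce hea =>
    ((h e hce (hea.le.trans le_sup_left) hea.ne fun h_eq => hba (h_eq ▸ hea.le)).2).resolve_left
      fun hbe => hba (hbe.trans hea.le)
  obtain ⟨q, hq, hq_valley⟩ := exists_isRaise_inf_isValley hba hcb hca fun e hce heb =>
    ((h e hce (heb.le.trans le_sup_right) (fun h_eq => hab (h_eq ▸ heb.le)) heb.ne).1).resolve_left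
      fun hae => hab (hae.trans heb.le)
  rw [inf_comm] at hq
  refine isRaise_of_isValley ?_ hp hq hp_valley hq_valley ((le_inf hca hcb).lt_of_ne hc) hcn
  rintro rfl
  refine hab (ext_count fun t ht => ?_).le
  have h_a := hp.2 t ht
  have h_b := hq.2 t ht
  omega

end Raises

end PluckerIndex

namespace PluckerIndex

variable {n : ℕ} {a a' b c e e' : PluckerIndex n} {t : ℕ}

variable (n) in
/-- The weights compatible with all Hibi relations, that is, the real valuations of the lattice of
Plücker indices. -/
def valuations : Submodule ℝ (PluckerIndex n → ℝ) where
  carrier := {w | ∀ a b, w a + w b = w (a ⊓ b) + w (a ⊔ b)}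
  add_mem' hw hw' a b := by
    have h := hw a b
    have h' := hw' a b
    simp only [Pi.add_apply]
    linarith
  zero_mem' _ _ := rfl
  smul_mem' r w hw a b := by
    simp only [Pi.smul_apply, ← smul_add, hw a b]

theorem mem_valuations {w : PluckerIndex n → ℝ} :
    w ∈ valuations n ↔ ∀ a b, w a + w b = w (a ⊓ b) + w (a ⊔ b) :=
  Iff.rfl

theorem pathWeight_mem_valuations (G : ℕ → ℕ → ℝ) : pathWeight G ∈ valuations n :=
  fun a b => (pathWeight_inf_add_sup G a b).symm

namespace IsRaise

theorem inf (h : IsRaise a e t) (h' : IsRaise a' e' t) : IsRaise (a ⊓ a') (e ⊓ e') t :=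
  ⟨h.1, fun s hs => by rw [count_inf, count_inf, h.2 s hs, h'.2 s hs, max_add_add_right]⟩

theorem sub_eq_sub_of_le {w : PluckerIndex n → ℝ} (hw : w ∈ valuations n) (h : IsRaise a e t)
    (h' : IsRaise a' e' t) (h_le : a' ≤ a) (h_eq : a.count t = a'.count t) :
    w e - w a = w e' - w a' := by
  have h_inf : e ⊓ a' = e' := ext_count fun s hs => by
    have := le_iff_count.1 h_le s
    rw [count_inf, h.2 s hs, h'.2 s hs]
    split_ifs with hst
    · subst hst
      omega
    · omega
  have h_sup : e ⊔ a' = a := ext_count fun s hs => by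
    have := le_iff_count.1 h_le s
    rw [count_sup, h.2 s hs]
    split_ifs with hst
    · subst hst
      omega
    · omega
  have h_val := mem_valuations.1 hw e a'
  rw [h_inf, h_sup] at h_val
  linarith

theorem sub_eq_sub {w : PluckerIndex n → ℝ} (hw : w ∈ valuations n) (h : IsRaise a e t)
    (h' : IsRaise a' e' t) (h_eq : a.count t = a'.count t) : w e - w a = w e' - w a' :=
  have h_inf : (a ⊓ a').count t = a.count t := by rw [count_inf, h_eq, max_self]
  (h.sub_eq_sub_of_le hw (h.inf h') inf_le_left h_inf.symm).trans
    (h'.sub_eq_sub_of_le hw (h.inf h') inf_le_right (h_inf.trans h_eq).symm).symm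

theorem pathWeight_sub (h : IsRaise a e (t + 1)) (G : ℕ → ℕ → ℝ) :
    pathWeight G e - pathWeight G a = G t (a.count (t + 1) + 1) - G t (a.count (t + 1)) := by
  have htn := h.1
  rw [pathWeight, pathWeight, ← Finset.sum_sub_distrib,
    Finset.sum_eq_single_of_mem t (Finset.mem_range.2 htn), h.count_self]
  intro s hs hst
  rw [h.count_of_ne (Finset.mem_range.1 hs) (by omega), sub_self]

end IsRaise

theorem apply_eq_of_isRaise_invariant {u : PluckerIndex n → ℝ}
    (hu : ∀ a e t, IsRaise a e t → u e = u a) (a b : PluckerIndex n) : u a = u b := by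
  have h_below (c a : PluckerIndex n) : c ≤ a → u c = u a := by
    induction a using WellFoundedLT.induction with
    | ind a ih =>
      intro hca
      obtain rfl | h_lt := hca.eq_or_lt
      · rfl
      · obtain ⟨t, e, he, -, hce⟩ := exists_isRaise_le_of_lt h_lt
        exact (ih e he.covBy.lt hce).trans (hu a e t he)
  exact (h_below _ a inf_le_left).symm.trans (h_below _ b inf_le_right)

/-- A common increment `g t m` belongs to all raises at place `t + 1` of paths of height `m`
there; summing it over the height gives `G`. -/
theorem exists_pathWeight_sub_eq {w : PluckerIndex n → ℝ} (hw : w ∈ valuations n) :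
    ∃ G, ∀ a e t, IsRaise a e t → pathWeight G e - pathWeight G a = w e - w a := by
  have h_increment (t m : ℕ) : ∃ x : ℝ, ∀ a e : PluckerIndex n,
      IsRaise a e (t + 1) → a.count (t + 1) = m → w e - w a = x := by
    by_cases! h : ∃ a e : PluckerIndex n, IsRaise a e (t + 1) ∧ a.count (t + 1) = m
    · obtain ⟨a, e, he, rfl⟩ := h
      exact ⟨w e - w a, fun a' e' he' h_eq => he'.sub_eq_sub hw he h_eq⟩
    · exact ⟨0, fun a e he h_eq => absurd h_eq (h a e he)⟩
  choose g hg using h_increment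
  refine ⟨fun t m => ∑ j ∈ Finset.range m, g t j, fun a e t he => ?_⟩
  obtain ⟨t, rfl⟩ := Nat.exists_eq_add_one.2 he.pos
  rw [he.pathWeight_sub, Finset.sum_range_succ, add_sub_cancel_left, hg t _ a e he rfl]

theorem exists_pathWeight_eq {w : PluckerIndex n → ℝ} (hw : w ∈ valuations n) :
    ∃ G, pathWeight G = w := by
  obtain h_empty | ⟨⟨a₀⟩⟩ := isEmpty_or_nonempty (PluckerIndex n)
  · exact ⟨0, funext fun a => h_empty.elim a⟩
  obtain ⟨G, hG⟩ := exists_pathWeight_sub_eq hw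
  have h_const := apply_eq_of_isRaise_invariant (u := fun a => w a - pathWeight G a)
    fun a e t he => by linarith [hG a e t he]
  have hn : 0 < n := a₀.len_pos.trans a₀.len_lt
  refine ⟨fun t m => G t m + if t = 0 then w a₀ - pathWeight G a₀ else 0, funext fun a => ?_⟩
  rw [pathWeight, Finset.sum_add_distrib, Finset.sum_ite_eq' (Finset.range n) 0,
    if_pos (Finset.mem_range.2 hn), ← h_const a]
  exact add_sub_cancel (pathWeight G a) (w a)

end PluckerIndex

namespace PluckerIndex

open MvPolynomial (monomial)
open Finsupp (weight)

section StraighteningInequalities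

variable {n : ℕ} {a b c d e : PluckerIndex n} {w w₀ : PluckerIndex n → ℝ} {s m : ℕ}

theorem isCompl_pluckerIdeal_standardSpan
    (hw₀ : w₀ ∈ groebnerCone (pluckerIdeal n) (nonstandardIdeal (PluckerIndex n))) :
    IsCompl ((pluckerIdeal n).restrictScalars ℂ)
      (standardSpan (incomparablePairs (PluckerIndex n))) :=
  isCompl_standardSpan finite_weight_bidegree_eq
    (fun _ hp δ => weightedHomogeneousComponent_mem_pluckerIdeal hp δ)
    (nonstandardIdeal_eq_monomialIdeal (L := PluckerIndex n) ▸ hw₀)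

variable {hc : IsCompl ((pluckerIdeal n).restrictScalars ℂ)
    (standardSpan (incomparablePairs (PluckerIndex n)))}

variable (hc) in
/-- A term of the straightening of a product of two incomparable variables, which gives rise to
the inequality `w left + w right ≤ (w, term)`. -/
structure StraighteningTerm where
  /-- The first of two incomparable indices. -/
  left : PluckerIndex n
  /-- The second of two incomparable indices. -/
  right : PluckerIndex n
  /-- The exponent of a monomial in the normal form of the product of the two variables. -/
  term : PluckerIndex n →₀ ℕ
  not_le : ¬ left ≤ right
  not_ge : ¬ right ≤ left
  mem : term ∈ (normalForm hc (monomial (pairExp left right) 1)).support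

namespace StraighteningTerm

instance : Finite (StraighteningTerm hc) := by
  refine Finite.of_injective (β := Σ p : PluckerIndex n × PluckerIndex n,
    (normalForm hc (monomial (pairExp p.1 p.2) 1)).support)
    (fun x => ⟨(x.left, x.right), x.term, x.mem⟩) ?_
  rintro ⟨a, b, q, _, _, _⟩ ⟨a', b', q', _, _, _⟩ h
  simp only [Sigma.mk.injEq, Prod.mk.injEq] at h
  obtain ⟨⟨rfl, rfl⟩, h_term⟩ := h
  simpa using h_term

/-- The linear functional whose nonnegativity is the inequality given by `x`. -/
def gap (x : StraighteningTerm hc) : Module.Dual ℝ (PluckerIndex n → ℝ) :=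
  weightFunctional x.term - weightFunctional (pairExp x.left x.right)

/-- The term of `x` is the one occurring in the Hibi relation. -/
def IsHibi (x : StraighteningTerm hc) : Prop :=
  x.term = pairExp (x.left ⊓ x.right) (x.left ⊔ x.right)

/-- The straightening term with the two incomparable indices exchanged. -/
def swap (x : StraighteningTerm hc) : StraighteningTerm hc :=
  ⟨x.right, x.left, x.term, x.not_ge, x.not_le, pairExp_comm x.left x.right ▸ x.mem⟩

variable {x y : StraighteningTerm hc}

theorem gap_apply (x : StraighteningTerm hc) (w : PluckerIndex n → ℝ) :
    gap x w = weight w x.term - weight w (pairExp x.left x.right) := by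
  rw [gap, LinearMap.sub_apply, weightFunctional_apply, weightFunctional_apply]

theorem gap_swap (x : StraighteningTerm hc) : gap x.swap = gap x := by
  rw [gap, gap, swap, pairExp_comm]

theorem gap_eq_zero_of_isHibi (hx : x.IsHibi) (hw : w ∈ valuations n) : gap x w = 0 := by
  rw [gap_apply, hx, weight_pairExp, weight_pairExp, mem_valuations.1 hw x.left x.right, sub_self]

theorem gap_single [DecidableEq (PluckerIndex n)] (x : StraighteningTerm hc) (e : PluckerIndex n) :
    gap x (Pi.single e 1) = (x.term e : ℝ) - (pairExp x.left x.right e : ℕ) := by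
  simp only [gap_apply, Finsupp.weight_single_index, nsmul_eq_mul, mul_one]

theorem exists_term_eq_pairExp (hx : ¬ x.IsHibi) :
    ∃ c d, x.term = pairExp c d ∧ c < x.left ⊓ x.right ∧ x.left ⊔ x.right ≤ d ∧
      bidegree x.left + bidegree x.right = bidegree c + bidegree d := by
  obtain ⟨c, d, h_term, h_inf, h_sup, h_deg⟩ :=
    exists_le_inf_sup_le_of_mem_support_normalForm hc x.not_le x.not_ge x.mem
  refine ⟨c, d, h_term, h_inf.lt_of_ne ?_, h_sup, h_deg⟩
  rintro rfl
  refine hx (h_term.trans (congrArg _ (ext_count fun t _ => ?_)))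
  have h_sum := count_add_count_of_bidegree h_deg t
  rw [count_inf] at h_sum
  rw [count_sup]
  omega

theorem closure_groebnerCone_nonstandardIdeal
    (hw₀ : w₀ ∈ groebnerCone (pluckerIdeal n) (nonstandardIdeal (PluckerIndex n))) :
    (∀ x : StraighteningTerm hc, 0 < gap x w₀) ∧
      closure (groebnerCone (pluckerIdeal n) (nonstandardIdeal (PluckerIndex n))) =
        polyhedralCone ⊤ (gap (hc := hc)) := by
  rw [nonstandardIdeal_eq_monomialIdeal] at hw₀ ⊢
  have h_iff {w : PluckerIndex n → ℝ} := mem_groebnerCone_monomialIdeal_iff (w := w)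
    finite_weight_bidegree_eq (fun _ hp δ => weightedHomogeneousComponent_mem_pluckerIdeal hp δ)
    hc hw₀
  have h_cone : groebnerCone (pluckerIdeal n) (monomialIdeal (incomparablePairs _)) =
      {w | w ∈ (⊤ : Submodule ℝ _) ∧ ∀ x : StraighteningTerm hc, 0 < gap x w} := by
    refine Set.ext fun w => h_iff.trans ⟨fun hw => ⟨trivial, fun x => ?_⟩, ?_⟩
    · exact gap_apply x w ▸
        sub_pos.2 (hw _ (pairExp_mem_incomparablePairs x.not_le x.not_ge) _ x.mem)
    · rintro ⟨-, hw⟩ _ ⟨a, b, hab, hba, rfl⟩ q hq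
      exact sub_pos.1 ((hw ⟨a, b, q, hab, hba, hq⟩).trans_eq (gap_apply _ w))
  have h_pos := (h_cone ▸ hw₀ : w₀ ∈ {w | _ ∧ ∀ x : StraighteningTerm hc, 0 < gap x w}).2
  exact ⟨h_pos, h_cone ▸ closure_strict_cone trivial h_pos⟩

theorem gap_pathWeight_sq_pos (hx : ¬ x.IsHibi) :
    0 < gap x (pathWeight fun _ k => (k : ℝ) ^ 2) := by
  rw [gap_apply]
  exact sub_pos.2 (lt_weight_of_initialPart_mem_diagIdeal hc x.not_le x.not_ge
    (strictlyConvex_sq.initialPart_mem_diagIdeal (by simp) (straightening_mem hc _)) x.mem hx)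

variable (hc) in
/-- The valuations which satisfy all straightening inequalities other than those given by Hibi
terms; this set turns out to be the closed cone of the Hibi degeneration. -/
def hibiCone : Set (PluckerIndex n → ℝ) :=
  polyhedralCone (valuations n) fun x : {x : StraighteningTerm hc // ¬ x.IsHibi} => gap x.1

theorem closure_groebnerCone_hibiIdeal
    (hw₀ : w₀ ∈ groebnerCone (pluckerIdeal n) (nonstandardIdeal (PluckerIndex n))) :
    closure (groebnerCone (pluckerIdeal n) (hibiIdeal (PluckerIndex n))) = hibiCone hc := by
  have h_cone : groebnerCone (pluckerIdeal n) (hibiIdeal (PluckerIndex n)) =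
      {w | w ∈ valuations n ∧ ∀ x : {x : StraighteningTerm hc // ¬ x.IsHibi}, 0 < gap x.1 w} := by
    refine Set.ext fun w => (mem_groebnerCone_hibiIdeal_iff hc hw₀).trans ⟨fun hw => ⟨?_, ?_⟩, ?_⟩
    · refine mem_valuations.2 fun a b => ?_
      by_cases hab : a ≤ b
      · rw [inf_eq_left.2 hab, sup_eq_right.2 hab]
      by_cases hba : b ≤ a
      · rw [inf_eq_right.2 hba, sup_eq_left.2 hba, add_comm]
      exact (hw a b hab hba).1
    · exact fun x => gap_apply x.1 w ▸
        sub_pos.2 ((hw _ _ x.1.not_le x.1.not_ge).2 _ x.1.mem x.2)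
    · rintro ⟨h_val, hw⟩ a b hab hba
      exact ⟨h_val a b, fun q hq h_ne =>
        sub_pos.1 ((hw ⟨⟨a, b, q, hab, hba, hq⟩, h_ne⟩).trans_eq (gap_apply _ w))⟩
  rw [h_cone, hibiCone, closure_strict_cone (pathWeight_mem_valuations _)
    fun x => gap_pathWeight_sq_pos x.2]

theorem hibiCone_subset : hibiCone hc ⊆ polyhedralCone ⊤ (gap (hc := hc)) := by
  rintro v ⟨h_val, h_nonneg⟩
  refine ⟨trivial, fun y => ?_⟩
  by_cases hy : y.IsHibi
  · exact (gap_eq_zero_of_isHibi hy h_val).ge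
  · exact h_nonneg ⟨y, hy⟩

theorem sep_inter_hibiCone (x : StraighteningTerm hc) :
    {v ∈ polyhedralCone ⊤ (gap (hc := hc)) | gap x v = 0} ∩ hibiCone hc =
      {v ∈ hibiCone hc | gap x v = 0} :=
  Set.ext fun _ => ⟨fun h => ⟨h.2, h.1.2⟩, fun h => ⟨⟨hibiCone_subset h.1, h.2⟩, h.1⟩⟩

theorem term_eq_of_gap_eq_smul (h_left : x.left = y.left) (h_right : x.right = y.right) {r : ℝ}
    (h : gap y = r • gap x) : y.term = x.term := by
  classical
  obtain ⟨a, b, q, hab, hba, hq⟩ := x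
  obtain ⟨_, _, q', _, _, hq'⟩ := y
  dsimp only at h_left h_right
  subst h_left h_right
  have h_apply (e : PluckerIndex n) : (q' e : ℝ) - (pairExp a b e : ℕ) =
      r * (q e - (pairExp a b e : ℕ)) := by
    have h_single := LinearMap.congr_fun h (Pi.single e 1)
    rwa [LinearMap.smul_apply, smul_eq_mul, gap_single, gap_single] at h_single
  have h_one : r = 1 := by
    have h_a := h_apply a
    have hne : a ≠ b := fun h_eq => hab h_eq.le
    rw [(apply_eq_zero_of_mem_support_normalForm hc hab hba hq).1,
      (apply_eq_zero_of_mem_support_normalForm hc hab hba hq').1] at h_a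
    have h_pair : pairExp a b a = 1 := by simp [pairExp, hne.symm]
    rw [h_pair] at h_a
    push_cast at h_a
    linarith
  refine Finsupp.ext fun e => ?_
  have h_e := h_apply e
  rw [h_one, one_mul, sub_left_inj] at h_e
  exact_mod_cast h_e

theorem gap_ne_smul (h_left : y.right ≠ x.left) (h_right : y.right ≠ x.right) {r : ℝ}
    (hr : 0 ≤ r) : gap y ≠ r • gap x := by
  classical
  intro h
  have h_single := LinearMap.congr_fun h (Pi.single y.right 1)
  have h_ne : y.left ≠ y.right := fun h_eq => y.not_le h_eq.le
  have h_y : pairExp y.left y.right y.right = 1 := by simp [pairExp, h_ne]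
  have h_x : pairExp x.left x.right y.right = 0 := by simp [pairExp, h_left, h_right]
  rw [LinearMap.smul_apply, smul_eq_mul, gap_single, gap_single, h_y, h_x,
    (apply_eq_zero_of_mem_support_normalForm hc y.not_le y.not_ge y.mem).2] at h_single
  have := mul_nonneg hr (Nat.cast_nonneg (α := ℝ) (x.term y.right))
  push_cast at h_single
  linarith

/-- The weight `w` satisfies all straightening inequalities, and those satisfied with equality are
exactly the positive multiples of `x`; so `w` is an inner point of the facet cut out by `x`. -/
structure IsSolelyTight (x : StraighteningTerm hc) (w : PluckerIndex n → ℝ) : Prop where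
  nonneg : ∀ y : StraighteningTerm hc, 0 ≤ gap y w
  gap_eq_zero : gap x w = 0
  exists_eq_smul : ∀ y : StraighteningTerm hc, gap y w = 0 → ∃ r : ℝ, 0 < r ∧ gap y = r • gap x

namespace IsSolelyTight

theorem swap (h : x.IsSolelyTight w) : x.swap.IsSolelyTight w :=
  ⟨h.nonneg, by rw [gap_swap, h.gap_eq_zero], by simpa only [gap_swap] using h.exists_eq_smul⟩

theorem pos (h : x.IsSolelyTight w) (h_ne : ∀ r : ℝ, 0 < r → gap y ≠ r • gap x) : 0 < gap y w :=
  (h.nonneg y).lt_of_ne' fun h0 =>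
    let ⟨r, hr, h_eq⟩ := h.exists_eq_smul y h0
    h_ne r hr h_eq

theorem left_comparable
    (hw₀ : w₀ ∈ groebnerCone (pluckerIdeal n) (nonstandardIdeal (PluckerIndex n)))
    (h : x.IsSolelyTight w) (h_term : x.term = pairExp c d) (hce : c ≤ e) (hed : e ≤ d)
    (h_left : e ≠ x.left) (h_right : e ≠ x.right) : x.left ≤ e ∨ e ≤ x.left := by
  by_contra! h_incomp
  obtain ⟨a, b, _, hab, hba, hq⟩ := x
  dsimp only at h_term h_left h_right h_incomp
  subst h_term
  rw [nonstandardIdeal_eq_monomialIdeal] at hw₀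
  have h_filtration : ∀ p ∈ incomparablePairs (PluckerIndex n),
      normalForm hc (monomial p 1) ∈ weightFiltration w (weight w p) := by
    rintro _ ⟨a', b', hab', hba', rfl⟩
    exact mem_weightFiltration.2 fun q hq' =>
      sub_nonneg.1 ((h.nonneg ⟨a', b', q, hab', hba', hq'⟩).trans_eq (gap_apply _ w))
  have h_tight := sub_eq_zero.1 ((gap_apply _ w).symm.trans h.gap_eq_zero)
  obtain ⟨q, hq', h_le⟩ := exists_weight_le_of_tight hc hw₀ h_filtration hq hce hed h_tight.symm
    fun q hq' h_ne => sub_pos.1 <| (h.pos (y := ⟨a, b, q, hab, hba, hq'⟩) fun r _ h_eq =>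
      h_ne (term_eq_of_gap_eq_smul (x := ⟨a, b, pairExp c d, hab, hba, hq⟩)
        (y := ⟨a, b, q, hab, hba, hq'⟩) rfl rfl h_eq)).trans_eq (gap_apply _ w)
  have h_pos := h.pos (y := ⟨a, e, q, h_incomp.1, h_incomp.2, hq'⟩) fun r hr =>
    gap_ne_smul h_left h_right hr.le
  exact h_le.not_gt (sub_pos.1 (h_pos.trans_eq (gap_apply _ w)))

end IsSolelyTight

/-- On path weights, the inequality given by `x` is the convexity of the sequence with index `s`
at `m`. -/
def IsSecondDifference (x : StraighteningTerm hc) (s m : ℕ) : Prop :=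
  ∀ G, gap x (pathWeight G) = G s (m + 1) + G s (m - 1) - 2 * G s m

theorem IsSolelyTight.exists_isSecondDifference
    (hw₀ : w₀ ∈ groebnerCone (pluckerIdeal n) (nonstandardIdeal (PluckerIndex n)))
    (h : x.IsSolelyTight w) (hx : ¬ x.IsHibi) :
    ∃ s m, 1 ≤ m ∧ x.IsSecondDifference s m := by
  obtain ⟨c, d, h_term, h_inf, h_sup, h_deg⟩ := exists_term_eq_pairExp hx
  obtain ⟨hca, hcb⟩ := le_inf_iff.1 h_inf.le
  have h_sum := count_add_count_of_bidegree h_deg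
  have h_end : c.count n = (x.left ⊓ x.right).count n := by
    rw [count_inf]
    simp only [count_of_le _ le_rfl]
    exact len_eq_max_of_bidegree (h_inf.le.trans (inf_le_sup.trans h_sup)) h_deg
  obtain ⟨y, hy, h_eq⟩ := interval_rigid x.not_le x.not_ge hca hcb h_end
    (fun e hce he h_left h_right =>
      ⟨h.left_comparable hw₀ h_term hce (he.trans h_sup) h_left h_right,
        h.swap.left_comparable hw₀ h_term hce (he.trans h_sup) h_right h_left⟩) h_inf.ne
  obtain ⟨s, rfl⟩ := Nat.exists_eq_add_one.2 hy.pos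
  have hs : s < n := hy.1
  have h_self := hy.count_self
  rw [count_inf, h_eq, max_self, ← h_eq] at h_self
  refine ⟨s, x.left.count (s + 1), by have := h_sum (s + 1); omega, fun G => ?_⟩
  rw [gap_apply, h_term]
  exact weight_pathWeight_sub_of_single (fun t _ => h_sum t) hs rfl h_eq.symm h_self
    (fun t ht hts => (hy.count_of_ne ht hts).trans (count_inf _ _ t)) G

theorem gap_flatConvex_pos_or_isSecondDifference (hx : ¬ x.IsHibi) (s m : ℕ) :
    0 < gap x (pathWeight (flatConvex s m)) ∨ x.IsSecondDifference s m := by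
  obtain ⟨c, d, h_term, h_inf, -, h_deg⟩ := exists_term_eq_pairExp hx
  obtain ⟨hca, hcb⟩ := le_inf_iff.1 h_inf.le
  have h_sum (t : ℕ) (_ : t ≤ n) := count_add_count_of_bidegree h_deg t
  obtain ⟨h_nonneg, h_zero⟩ := weight_flatConvex_sub (s := s) (m := m) h_sum hca hcb
  rw [gap_apply, h_term]
  refine h_nonneg.lt_or_eq.imp id fun h0 => ?_
  have h_cases := h_zero h0.symm
  obtain ⟨y, hy, h_gap⟩ : ∃ y ≤ n, (x.left ⊓ x.right).count y < c.count y := by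
    by_contra! h
    exact h_inf.not_ge (le_iff_count_of_le.2 h)
  rw [count_inf] at h_gap
  obtain _ | t := y
  · simp at h_gap
  obtain ⟨rfl, ha, hb, hc'⟩ := (h_cases t hy).resolve_left h_gap.ne'
  refine fun G => (gap_apply x _).trans (h_term ▸
    weight_pathWeight_sub_of_single h_sum hy ha hb hc' (fun r hr hrt => ?_) G)
  obtain _ | r := r
  · simp
  · exact (h_cases r hr).resolve_right fun h => hrt (congrArg _ h.1)

theorem IsSecondDifference.gap_flatConvex_eq_zero (h : x.IsSecondDifference s m) (hm : 1 ≤ m) :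
    gap x (pathWeight (flatConvex s m)) = 0 := by
  obtain ⟨k, rfl⟩ := Nat.exists_eq_add_one.2 hm
  have h_flat : flatSlope (k + 1) (k + 1) = flatSlope (k + 1) k := by simp [flatSlope]
  rw [h, Nat.add_sub_cancel]
  simp only [flatConvex, if_true, Finset.sum_range_succ, h_flat]
  ring

theorem IsSecondDifference.isFacet (h : x.IsSecondDifference s m) (hm : 1 ≤ m) (hx : ¬ x.IsHibi) :
    IsFacet {v ∈ hibiCone hc | gap x v = 0} (hibiCone hc) := by
  refine isFacet_of_tight (ℓ := fun x : {x : StraighteningTerm hc // ¬ x.IsHibi} => gap x.1)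
    (i₀ := ⟨x, hx⟩) (pathWeight_mem_valuations _) (fun y => gap_pathWeight_sq_pos y.2)
    (pathWeight_mem_valuations (flatConvex s m)) (h.gap_flatConvex_eq_zero hm) fun y =>
    (gap_flatConvex_pos_or_isSecondDifference y.2 s m).imp id fun hy v hv hv0 => ?_
  obtain ⟨G, rfl⟩ := exists_pathWeight_eq hv
  rwa [hy, ← h]

end StraighteningTerm

end StraighteningInequalities

end PluckerIndex

end

open PluckerIndex PluckerIndex.StraighteningTerm in
theorem mainTheorem9 (n : ℕ) (hn : 2 ≤ n) (F : Set (PluckerIndex n → ℝ))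
    (hF : IsFacet F
      (closure (groebnerCone (pluckerIdeal n) (nonstandardIdeal (PluckerIndex n))))) :
    closure (groebnerCone (pluckerIdeal n) (hibiIdeal (PluckerIndex n))) ⊆ F ∨
      IsFacet (F ∩ closure (groebnerCone (pluckerIdeal n) (hibiIdeal (PluckerIndex n))))
        (closure (groebnerCone (pluckerIdeal n) (hibiIdeal (PluckerIndex n)))) := by
  obtain ⟨w₀, hw₀⟩ := closure_nonempty_iff.1 (hF.1.mono hF.2.1.subset)
  have hc := isCompl_pluckerIdeal_standardSpan hw₀
  obtain ⟨h_pos, h_cone⟩ := closure_groebnerCone_nonstandardIdeal (hc := hc) hw₀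
  rw [h_cone] at hF
  rw [closure_groebnerCone_hibiIdeal (hc := hc) hw₀]
  obtain ⟨x, rfl, w, ⟨hw, hw0⟩, h_smul⟩ := hF.exists_inequality h_pos
  by_cases hx : x.IsHibi
  · exact Or.inl fun v hv => ⟨hibiCone_subset hv, gap_eq_zero_of_isHibi hx hv.1⟩
  · have h_tight : x.IsSolelyTight w := ⟨hw.2, hw0, h_smul⟩
    obtain ⟨s, m, hm, h_diff⟩ := h_tight.exists_isSecondDifference hw₀ hx
    exact Or.inr (sep_inter_hibiCone x ▸ h_diff.isFacet hm hx)
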